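/- Let $\mathfrak p_1=2<\mathfrak p_2=3<\dots$ be the primes and write $\mathfrak p^{\alpha}=\prod_j \mathfrak p_j^{\alpha_j}$, $z^\alpha=\prod_j z_j^{\alpha_j}$ for finitely supported multi-indices $\alpha\in\mathbb N_0^{(\mathbb N)}$. Let $\mathcal H^2$ be the completion of the Dirichlet polynomials $\sum_{n\le M} a_n n^{-s}$ under the norm $\lim_{R\to\infty}\big(\frac1{2R}\int_{-R}^{R}|\sum_{n\le M} a_n n^{-it}|^2dt\big)^{1/2}$, regarded as a space of Dirichlet series through the coefficients. For $k\in\mathbb N=\{1,2,\dots\}$ let $$\mathcal H^2_k=\Big\{\sum a_n n^{-s}:\ \sum \tfrac{a_n}{n^{1/k}}n^{-s}\in\mathcal H^2\Big\},\qquad \Big\|\sum a_n n^{-s}\Big\|_{2,k}=\Big\|\sum \tfrac{a_n}{n^{1/k}}n^{-s}\Big\|_{\mathcal H^2}.$$ Let $\mathcal H_+$ be the space of those Dirichlet series $\sum a_nn^{-s}$ that converge at some point and satisfy $\inf\{\sigma\in\mathbb R: \sum \frac{a_n}{n^{\sigma}}n^{-s}\in\mathcal H^2\}\le 0$, with the topology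 defined by the seminorms $\|\cdot\|_{2,k}$, $k\in\mathbb N$. Let $\ell_2(\mathfrak p^{1/k})$ be the space of complex sequences $z$ with $\big(\sum_j|z_j\mathfrak p_j^{1/k}|^2\big)^{1/2}<\infty$, with this norm, let $B_{\ell_\infty(\mathfrak p^{1/k})}=\{z\in\mathbb C^{\mathbb N}:\sup_j|z_j\mathfrak p_j^{1/k}|<1\}$, and let $\Omega_k=\ell_2(\mathfrak p^{1/k})\cap B_{\ell_\infty(\mathfrak p^{1/k})}$, an open subset of $\ell_2(\mathfrak p^{1/k})$; note that $\Omega_1\subseteq\Omega_2\subseteq\cdots$. Let $H^2(\Omega_k)$ be the space of holomorphic (i.e. Fréchet differentiable at every point) functions $f:\Omega_k\to\mathbb C$ with $$\|f\|=\sup_{N\ge1}\ \sup_{0<r_j<\mathfrak p_j^{-1/k},\,1\le j\le N}\Big(\int_{\mathbb T^N}|f(r_1z_1,\dots,r_Nz_N,0,0,\dots)|^2dz\Big)^{1/2}<\infty,$$ where $dz$ is the normalized Lebesgue measure on $\mathbb T^N$. The monomial coefficients of $f$ are the unique numbers $c_\alpha(f)$ with $f(z)=\sum_\alpha c_\alpha(f)z^\alpha$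 for every finitely supported $z\in\Omega_k$. (i) For every $k\in\mathbb N$, $\mathcal H^2_k=H^2(\Omega_k)$ as Banach spaces: both are complete, and there is a linear isometric bijection $\mathcal H^2_k\to H^2(\Omega_k)$ that sends $\sum a_nn^{-s}$ to a function $f$ with $c_\alpha(f)=a_{\mathfrak p^\alpha}$ for all $\alpha$. (ii) $\mathcal H_+=\bigcap_{k=1}^\infty H^2(\Omega_k)$, where the intersection is the space of functions on $\bigcup_k\Omega_k$ whose restriction to $\Omega_k$ belongs to $H^2(\Omega_k)$ for every $k$, with the topology of the projective limit (the coarsest topology for which all the restriction maps into the spaces $H^2(\Omega_k)$ are continuous). That is, there is a linear homeomorphism from $\mathcal H_+$ onto this intersection that sends $\sum a_nn^{-s}$ to a function $f$ with $c_\alpha(f|_{\Omega_k})=a_{\mathfrak p^\alpha}$ and $\|f|_{\Omega_k}\|=\|\sum a_nn^{-s}\|_{2,k}$ for all $\alpha$ and $k$. -/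

import Mathlib

open Filter Topology MeasureTheory
open scoped ENNReal

noncomputable section

/-- Dirichlet polynomials `∑ aₙ n⁻ˢ`, given by their finitely many nonzero coefficients. -/
def DirichletPoly : Type := ℕ+ →₀ ℂ

namespace DirichletPoly

instance : AddCommGroup DirichletPoly := inferInstanceAs (AddCommGroup (ℕ+ →₀ ℂ))
instance : Module ℂ DirichletPoly := inferInstanceAs (Module ℂ (ℕ+ →₀ ℂ))

/-- The linear map that reads off the coefficients of a Dirichlet polynomial. -/
def coeffs : DirichletPoly →ₗ[ℂ] (ℕ+ → ℂ) where
  toFun P := fun n => (show ℕ+ →₀ ℂ from P) n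
  map_add' _ _ := rfl
  map_smul' _ _ := rfl

/-- The finite set of indices with nonzero coefficient. -/
def supp (P : DirichletPoly) : Finset ℕ+ := Finsupp.support (show ℕ+ →₀ ℂ from P)

/-- The value `P(s) = ∑ aₙ n⁻ˢ`. -/
def eval (P : DirichletPoly) (s : ℂ) : ℂ := ∑ n ∈ P.supp, coeffs P n * (n : ℂ) ^ (-s)

/-- `(1/(2R) ∫_{-R}^{R} |P(it)|² dt)^{1/2}`. -/
def meanSq (P : DirichletPoly) (R : ℝ) : ℝ :=
  ((1 / (2 * R)) * ∫ t in (-R)..R, ‖P.eval (Complex.I * t)‖ ^ 2) ^ (1 / 2 : ℝ)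

/-- The norm of `𝓗²` on Dirichlet polynomials: the limit of `meanSq P R` as `R → ∞`. -/
instance : Norm DirichletPoly := ⟨fun P => limUnder atTop P.meanSq⟩

lemma norm_def (P : DirichletPoly) : ‖P‖ = limUnder atTop P.meanSq := rfl

lemma coeffs_injective : Function.Injective coeffs := fun P Q h =>
  DFunLike.coe_injective (F := ℕ+ →₀ ℂ) (a₁ := P) (a₂ := Q) h

lemma tendsto_mean_exp (ω : ℝ) :
    Tendsto (fun R : ℝ => (1 / (2 * R) : ℂ) * ∫ t in (-R)..R, Complex.exp (Complex.I * ω * t))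
      atTop (𝓝 (if ω = 0 then 1 else 0)) := by
  split_ifs with h
  · subst h
    refine tendsto_const_nhds.congr' ?_
    filter_upwards [eventually_gt_atTop 0] with R hR
    have : (R : ℂ) ≠ 0 := by exact_mod_cast hR.ne'
    simp
    field_simp
    norm_num
  · have hc : Complex.I * ω ≠ 0 := by simp [h]
    have hb : ∀ R : ℝ, 0 < R → ‖(1 / (2 * R) : ℂ) * ∫ t in (-R)..R, Complex.exp (Complex.I * ω * t)‖
        ≤ |ω|⁻¹ * R⁻¹ := by
      intro R hR
      rw [integral_exp_mul_complex hc, norm_mul, norm_div, norm_div]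
      have e : ∀ x : ℝ, ‖Complex.exp (Complex.I * ω * x)‖ = 1 := by
        intro x
        have := Complex.norm_exp_ofReal_mul_I (ω * x)
        rw [← this]; congr 2; push_cast; ring
      have := norm_sub_le (Complex.exp (Complex.I * ω * R)) (Complex.exp (Complex.I * ω * (-R : ℝ)))
      rw [e, e] at this
      simp only [norm_mul, Complex.norm_I, Complex.norm_real, Real.norm_eq_abs, norm_one,
        Complex.norm_ofNat, abs_of_pos hR, one_mul]
      have hw : 0 < |ω| := abs_pos.mpr h
      calc _ ≤ 1 / (2 * R) * ((1 + 1) / |ω|) := by gcongr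
        _ = _ := by field_simp; norm_num
    refine squeeze_zero_norm' (a := fun R => |ω|⁻¹ * R⁻¹) ?_ ?_
    · filter_upwards [eventually_gt_atTop 0] with R hR using hb R hR
    · simpa using tendsto_inv_atTop_zero.const_mul (|ω|⁻¹)

lemma tendsto_meanSq (P : DirichletPoly) :
    Tendsto P.meanSq atTop (𝓝 ((∑ n ∈ P.supp, ‖coeffs P n‖ ^ 2) ^ (1 / 2 : ℝ))) := by
  have key : Tendsto (fun R : ℝ => (1 / (2 * R)) * ∫ t in (-R)..R, ‖P.eval (Complex.I * t)‖ ^ 2)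
      atTop (𝓝 (∑ n ∈ P.supp, ‖coeffs P n‖ ^ 2)) := by
    rw [← Filter.tendsto_ofReal_iff]
    have hpow : ∀ (n : ℕ+) (t : ℝ), (n : ℂ) ^ (-(Complex.I * t)) =
        Complex.exp (Complex.I * (-Real.log n : ℝ) * t) := by
      intro n t
      rw [Complex.cpow_def_of_ne_zero (by exact_mod_cast n.pos.ne'), ← Complex.natCast_log]
      congr 1; push_cast; ring
    have hexp : ∀ t : ℝ, ((‖P.eval (Complex.I * t)‖ ^ 2 : ℝ) : ℂ) = ∑ n ∈ P.supp, ∑ m ∈ P.supp,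
        coeffs P n * (starRingEnd ℂ) (coeffs P m) *
          Complex.exp (Complex.I * (Real.log m - Real.log n : ℝ) * t) := by
      intro t
      rw [← Complex.normSq_eq_norm_sq, ← Complex.mul_conj, eval, map_sum, Finset.sum_mul_sum]
      refine Finset.sum_congr rfl fun n _ => Finset.sum_congr rfl fun m _ => ?_
      rw [hpow, hpow, map_mul, ← Complex.exp_conj, mul_mul_mul_comm, ← Complex.exp_add]
      congr 2
      simp only [map_mul, Complex.conj_I, Complex.conj_ofReal]
      push_cast
      ring
    have hint : ∀ R : ℝ, (((1 / (2 * R)) * ∫ t in (-R)..R, ‖P.eval (Complex.I * t)‖ ^ 2 : ℝ) : ℂ)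
        = ∑ n ∈ P.supp, ∑ m ∈ P.supp, coeffs P n * (starRingEnd ℂ) (coeffs P m) *
          ((1 / (2 * R) : ℂ) * ∫ t in (-R)..R,
            Complex.exp (Complex.I * (Real.log m - Real.log n : ℝ) * t)) := by
      intro R
      rw [Complex.ofReal_mul, ← intervalIntegral.integral_ofReal]
      simp_rw [hexp]
      rw [intervalIntegral.integral_finsetSum, Finset.mul_sum]
      · refine Finset.sum_congr rfl fun n _ => ?_
        rw [intervalIntegral.integral_finsetSum, Finset.mul_sum]
        · refine Finset.sum_congr rfl fun m _ => ?_
          rw [intervalIntegral.integral_const_mul]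
          push_cast; ring
        · intro m _
          exact Continuous.intervalIntegrable (by fun_prop) _ _
      · intro n _
        exact Continuous.intervalIntegrable (by fun_prop) _ _
    refine Tendsto.congr (fun R => (hint R).symm) ?_
    have : ((∑ n ∈ P.supp, ‖coeffs P n‖ ^ 2 : ℝ) : ℂ) = ∑ n ∈ P.supp, ∑ m ∈ P.supp,
        coeffs P n * (starRingEnd ℂ) (coeffs P m) *
          (if Real.log m - Real.log n = 0 then 1 else 0) := by
      push_cast
      refine Finset.sum_congr rfl fun n hn => ?_
      rw [Finset.sum_eq_single n]
      · simp [Complex.mul_conj, Complex.normSq_eq_norm_sq]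
      · intro m _ hmn
        rw [if_neg, mul_zero]
        intro h
        apply hmn
        have := Real.log_injOn_pos (Set.mem_Ioi.2 (Nat.cast_pos.2 m.pos))
          (Set.mem_Ioi.2 (Nat.cast_pos.2 n.pos)) (sub_eq_zero.mp h)
        exact_mod_cast this
      · intro h; exact absurd hn h
    rw [this]
    exact tendsto_finsetSum _ fun n _ => tendsto_finsetSum _ fun m _ =>
      (tendsto_mean_exp _).const_mul _
  exact key.rpow_const (Or.inr (by norm_num))

lemma memlp_coeffs (P : DirichletPoly) : Memℓp (coeffs P) 2 :=
  (memℓp_zero (Set.Finite.subset P.supp.finite_toSet fun n hn =>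
    Finsupp.mem_support_iff.2 hn)).of_exponent_ge (by simp)

/-- The coefficients of a Dirichlet polynomial, as an element of `ℓ²`. -/
def toLp : DirichletPoly →ₗ[ℂ] lp (fun _ : ℕ+ => ℂ) 2 where
  toFun P := ⟨coeffs P, memlp_coeffs P⟩
  map_add' _ _ := rfl
  map_smul' _ _ := rfl

lemma norm_toLp (P : DirichletPoly) : ‖toLp P‖ = ‖P‖ := by
  rw [norm_def, (tendsto_meanSq P).limUnder_eq, lp.norm_eq_tsum_rpow (by simp)]
  simp only [ENNReal.toReal_ofNat, Real.rpow_ofNat]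
  congr 1
  refine tsum_eq_sum fun n hn => ?_
  have : coeffs P n = 0 := Finsupp.notMem_support_iff.1 hn
  change ‖coeffs P n‖ ^ 2 = 0
  simp [this]

lemma normCore : NormedSpace.Core ℂ DirichletPoly where
  norm_nonneg P := by rw [← norm_toLp]; exact norm_nonneg _
  norm_smul c P := by rw [← norm_toLp, map_smul, norm_smul, norm_toLp]
  norm_triangle P Q := by
    rw [← norm_toLp, ← norm_toLp P, ← norm_toLp Q, map_add]; exact norm_add_le _ _
  norm_eq_zero_iff P := by
    rw [← norm_toLp, norm_eq_zero]
    constructor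
    · intro h
      exact coeffs_injective (congrArg Subtype.val h)
    · rintro rfl; exact map_zero _

instance : NormedAddCommGroup DirichletPoly := NormedAddCommGroup.ofCore normCore
instance : NormedSpace ℂ DirichletPoly := NormedSpace.ofCore normCore

end DirichletPoly

/-- The Hardy space `𝓗²`: the completion of the Dirichlet polynomials under the mean-square norm. -/
abbrev DirichletH2 : Type := UniformSpace.Completion DirichletPoly

namespace DirichletH2

/-- The `n`-th coefficient of a Dirichlet polynomial as a bounded functional. -/
def polyCoeff (n : ℕ+) : DirichletPoly →L[ℂ] ℂ :=
  ((LinearMap.proj n).comp DirichletPoly.coeffs).mkContinuous 1 fun P => by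
    rw [one_mul, ← DirichletPoly.norm_toLp]
    exact lp.norm_apply_le_norm (by simp) (DirichletPoly.toLp P) n

/-- The coefficients of an element of `𝓗²`: the continuous extensions to the completion of the
coefficient functionals. -/
def coeffs : DirichletH2 →ₗ[ℂ] (ℕ+ → ℂ) :=
  LinearMap.pi fun n => ((polyCoeff n).extend
    (UniformSpace.Completion.toComplL (𝕜 := ℂ) (E := DirichletPoly))).toLinearMap

lemma isUniformInducing_toComplL :
    IsUniformInducing (UniformSpace.Completion.toComplL (𝕜 := ℂ) (E := DirichletPoly)) :=
  UniformSpace.Completion.isUniformInducing_coe _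

lemma denseRange_toComplL :
    DenseRange (UniformSpace.Completion.toComplL (𝕜 := ℂ) (E := DirichletPoly)) :=
  UniformSpace.Completion.denseRange_coe

lemma coeffs_coe (P : DirichletPoly) (n : ℕ+) :
    coeffs (P : DirichletH2) n = DirichletPoly.coeffs P n :=
  (polyCoeff n).extend_eq denseRange_toComplL isUniformInducing_toComplL P

lemma continuous_coeffs (n : ℕ+) : Continuous fun x => coeffs x n :=
  ((polyCoeff n).extend
    (UniformSpace.Completion.toComplL (𝕜 := ℂ) (E := DirichletPoly))).continuous

/-- The isometry of `𝓗²` into `ℓ²`. -/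
def toLpCLM : DirichletH2 →L[ℂ] lp (fun _ : ℕ+ => ℂ) 2 :=
  (DirichletPoly.toLp.mkContinuous 1 fun P => by
    rw [one_mul, DirichletPoly.norm_toLp]).extend
      (UniformSpace.Completion.toComplL (𝕜 := ℂ) (E := DirichletPoly))

lemma toLpCLM_coe (P : DirichletPoly) : toLpCLM (P : DirichletH2) = DirichletPoly.toLp P :=
  ContinuousLinearMap.extend_eq _ denseRange_toComplL isUniformInducing_toComplL P

lemma norm_toLpCLM (x : DirichletH2) : ‖toLpCLM x‖ = ‖x‖ := by
  induction x using UniformSpace.Completion.induction_on with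
  | hp => exact isClosed_eq (by fun_prop) (by fun_prop)
  | ih P => rw [toLpCLM_coe, DirichletPoly.norm_toLp, UniformSpace.Completion.norm_coe]

lemma toLpCLM_apply (x : DirichletH2) (n : ℕ+) : (toLpCLM x : ℕ+ → ℂ) n = coeffs x n := by
  induction x using UniformSpace.Completion.induction_on with
  | hp =>
    refine isClosed_eq ?_ (continuous_coeffs n)
    exact (lp.evalCLM ℂ (fun _ : ℕ+ => ℂ) 2 n).continuous.comp toLpCLM.continuous
  | ih P => rw [toLpCLM_coe, coeffs_coe]; rfl

lemma coeffs_injective : Function.Injective coeffs := by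
  intro x y h
  have : toLpCLM x = toLpCLM y := by
    ext n; rw [toLpCLM_apply, toLpCLM_apply, h]
  rw [← sub_eq_zero, ← norm_eq_zero, ← norm_toLpCLM, map_sub, this, sub_self, norm_zero]

lemma toLpCLM_surjective : Function.Surjective toLpCLM := by
  have hiso : Isometry toLpCLM := AddMonoidHomClass.isometry_of_norm _ norm_toLpCLM
  have hcl : IsClosed (Set.range toLpCLM) := hiso.isClosedEmbedding.isClosed_range
  intro y
  have hy := lp.hasSum_single (by simp) y
  refine hcl.mem_of_tendsto hy (Eventually.of_forall fun s => ?_)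
  change _ ∈ LinearMap.range toLpCLM.toLinearMap
  refine Submodule.sum_mem _ fun n _ => 
    ⟨UniformSpace.Completion.coe' (show DirichletPoly from (Finsupp.single n (y n) : ℕ+ →₀ ℂ)), ?_⟩
  change toLpCLM _ = _
  rw [toLpCLM_coe]
  ext m
  change (Finsupp.single n (y n) : ℕ+ →₀ ℂ) m = _
  rw [Finsupp.single_apply, lp.single_apply, Pi.single_apply]
  simp only [eq_comm]

end DirichletH2

/-- `𝓗²` as a space of (formal) Dirichlet series, which are identified with the sequences of their
coefficients. -/
def h2Series : Submodule ℂ (ℕ+ → ℂ) := LinearMap.range DirichletH2.coeffs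

lemma mem_h2Series_iff (a : ℕ+ → ℂ) : a ∈ h2Series ↔ Memℓp a 2 := by
  constructor
  · rintro ⟨x, rfl⟩
    have : DirichletH2.coeffs x = (DirichletH2.toLpCLM x : ℕ+ → ℂ) :=
      funext fun n => (DirichletH2.toLpCLM_apply x n).symm
    rw [this]
    exact (DirichletH2.toLpCLM x).2
  · intro h
    obtain ⟨x, hx⟩ := DirichletH2.toLpCLM_surjective ⟨a, h⟩
    exact ⟨x, funext fun n => by rw [← DirichletH2.toLpCLM_apply, hx]⟩

/-- The translation `∑ aₙ n⁻ˢ ↦ ∑ (aₙ / n^σ) n⁻ˢ`. -/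
def shiftSeries (σ : ℝ) : (ℕ+ → ℂ) →ₗ[ℂ] (ℕ+ → ℂ) where
  toFun a := fun n => a n / (((n : ℝ) ^ σ : ℝ) : ℂ)
  map_add' a b := by ext n; simp [add_div]
  map_smul' c a := by ext n; simp [mul_div_assoc]

lemma shiftSeries_injective (σ : ℝ) : Function.Injective (shiftSeries σ) := by
  intro a b h
  ext n
  have hn : (((n : ℝ) ^ σ : ℝ) : ℂ) ≠ 0 := by
    exact_mod_cast (Real.rpow_pos_of_pos (Nat.cast_pos.2 n.pos) σ).ne'
  exact (div_left_inj' hn).1 (congrFun h n)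

/-- The Dirichlet series `∑ aₙ n⁻ˢ` with `∑ (aₙ / n^{1/k}) n⁻ˢ` in `𝓗²`. -/
def h2kSeries (k : ℕ+) : Submodule ℂ (ℕ+ → ℂ) := h2Series.comap (shiftSeries (1 / (k : ℝ)))

/-- The space `𝓗²ₖ` of Dirichlet series, with the norm
`‖∑ aₙ n⁻ˢ‖_{2,k} = ‖∑ (aₙ / n^{1/k}) n⁻ˢ‖_{𝓗²}`. -/
def DirichletH2k (k : ℕ+) : Type := h2kSeries k

namespace DirichletH2k

instance (k : ℕ+) : AddCommGroup (DirichletH2k k) := inferInstanceAs (AddCommGroup (h2kSeries k))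
instance (k : ℕ+) : Module ℂ (DirichletH2k k) := inferInstanceAs (Module ℂ (h2kSeries k))

/-- The coefficients of a series in `𝓗²ₖ`. -/
def coeffs (k : ℕ+) : DirichletH2k k →ₗ[ℂ] (ℕ+ → ℂ) := (h2kSeries k).subtype

/-- The translation `𝓗²ₖ → 𝓗²`, `∑ aₙ n⁻ˢ ↦ ∑ (aₙ / n^{1/k}) n⁻ˢ`. -/
def toH2 (k : ℕ+) : DirichletH2k k →ₗ[ℂ] DirichletH2 :=
  (LinearEquiv.ofInjective DirichletH2.coeffs DirichletH2.coeffs_injective).symm.toLinearMap ∘ₗ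
    (shiftSeries (1 / (k : ℝ))).restrict (p := h2kSeries k) (q := h2Series) fun _ h => h

lemma toH2_injective (k : ℕ+) : Function.Injective (toH2 k) := by
  intro a b h
  have h' := (LinearEquiv.ofInjective DirichletH2.coeffs
    DirichletH2.coeffs_injective).symm.injective h
  exact Subtype.ext (shiftSeries_injective _ (congrArg Subtype.val h'))

instance (k : ℕ+) : NormedAddCommGroup (DirichletH2k k) :=
  NormedAddCommGroup.induced (DirichletH2k k) DirichletH2 (toH2 k) (toH2_injective k)

instance (k : ℕ+) : NormedSpace ℂ (DirichletH2k k) := NormedSpace.induced ℂ _ _ (toH2 k)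

end DirichletH2k

/-- The Dirichlet series `∑ aₙ n⁻ˢ` that converge at some point `s`. -/
def ConvergesSomewhere (a : ℕ+ → ℂ) : Prop :=
  ∃ s l : ℂ, Tendsto (fun N : ℕ => ∑ n ∈ Finset.range N, a n.succPNat * (n.succPNat : ℂ) ^ (-s))
    atTop (𝓝 l)

/-- The `𝓗²`-abscissa: the infimum of the real `σ` with `∑ (aₙ / n^σ) n⁻ˢ` in `𝓗²`, as an
extended real number (so `⊤` if there is no such `σ`). -/
def h2Abscissa (a : ℕ+ → ℂ) : EReal := ⨅ (σ : ℝ) (_ : shiftSeries σ a ∈ h2Series), (σ : EReal)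

lemma shiftSeries_mem_of_le {a : ℕ+ → ℂ} {σ τ : ℝ} (h : σ ≤ τ) (ha : shiftSeries σ a ∈ h2Series) :
    shiftSeries τ a ∈ h2Series := by
  rw [mem_h2Series_iff] at ha ⊢
  refine ha.mono' fun n => ?_
  change ‖a n / _‖ ≤ ‖a n / _‖
  have hn : (1 : ℝ) ≤ n := by exact_mod_cast n.pos
  rw [norm_div, norm_div, Complex.norm_real, Complex.norm_real,
    Real.norm_of_nonneg (by positivity), Real.norm_of_nonneg (by positivity)]
  gcongr

lemma convergesSomewhere_of_shiftSeries_mem {a : ℕ+ → ℂ} {σ : ℝ} (ha : shiftSeries σ a ∈ h2Series) :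
    ConvergesSomewhere a := by
  rw [mem_h2Series_iff, memℓp_gen_iff (by simp)] at ha
  simp only [ENNReal.toReal_ofNat, Real.rpow_ofNat] at ha
  have ha' := (Equiv.pnatEquivNat.symm.summable_iff).2 ha
  have h2 : Summable fun n : ℕ => (((n + 1 : ℕ) : ℝ) ^ 2)⁻¹ :=
    (summable_nat_add_iff 1).2 (Real.summable_nat_pow_inv.2 (by norm_num))
  have hs : Summable fun n : ℕ => a n.succPNat * (n.succPNat : ℂ) ^ (-((σ + 1 : ℝ) : ℂ)) := by
    refine Summable.of_norm_bounded (ha'.add h2) fun n => ?_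
    have hpos : (0 : ℝ) < (n.succPNat : ℕ) := Nat.cast_pos.2 n.succPNat.pos
    change ‖_‖ ≤ ‖shiftSeries σ a n.succPNat‖ ^ 2 + (((n + 1 : ℕ) : ℝ) ^ 2)⁻¹
    have e : ‖a n.succPNat * (n.succPNat : ℂ) ^ (-((σ + 1 : ℝ) : ℂ))‖ =
        ‖shiftSeries σ a n.succPNat‖ * ((n + 1 : ℕ) : ℝ)⁻¹ := by
      change _ = ‖a n.succPNat / _‖ * _
      rw [norm_mul, norm_div, Complex.norm_real, Real.norm_of_nonneg (by positivity),
        Complex.norm_natCast_cpow_of_pos n.succPNat.pos]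
      have : (-((σ + 1 : ℝ) : ℂ)).re = -σ + -1 := by simp; ring
      rw [this, Real.rpow_add hpos, Real.rpow_neg hpos.le, Real.rpow_neg_one]
      simp only [Nat.succPNat_coe, Nat.succ_eq_add_one]
      ring
    rw [e]
    have := two_mul_le_add_sq ‖shiftSeries σ a n.succPNat‖ (((n + 1 : ℕ) : ℝ)⁻¹)
    have h3 : 0 ≤ ‖shiftSeries σ a n.succPNat‖ * ((n + 1 : ℕ) : ℝ)⁻¹ := by positivity
    rw [inv_pow] at this
    linarith
  exact ⟨_, _, hs.hasSum.tendsto_sum_nat⟩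

lemma hplus_iff (a : ℕ+ → ℂ) :
    (ConvergesSomewhere a ∧ h2Abscissa a ≤ 0) ↔ a ∈ ⨅ k : ℕ+, h2kSeries k := by
  rw [Submodule.mem_iInf]
  constructor
  · rintro ⟨-, h⟩ k
    have hk : (0 : EReal) < ((1 / (k : ℝ) : ℝ) : EReal) := by
      have : (0 : ℝ) < k := Nat.cast_pos.2 k.pos
      exact_mod_cast (by positivity : (0 : ℝ) < 1 / (k : ℝ))
    have := h.trans_lt hk
    simp only [h2Abscissa, iInf_lt_iff] at this
    obtain ⟨σ, hσ, hlt⟩ := this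
    exact shiftSeries_mem_of_le (EReal.coe_lt_coe_iff.1 hlt).le hσ
  · intro h
    refine ⟨convergesSomewhere_of_shiftSeries_mem (h 1), ?_⟩
    refine le_of_forall_gt fun c hc => ?_
    obtain ⟨ε, hε, hεc⟩ := EReal.lt_iff_exists_real_btwn.1 hc
    obtain ⟨k, hk⟩ := exists_nat_one_div_lt (EReal.coe_pos.1 hε)
    refine lt_of_le_of_lt (iInf₂_le (1 / ((k.succPNat : ℕ+) : ℝ)) (h k.succPNat)) ?_
    refine lt_trans ?_ hεc
    rw [EReal.coe_lt_coe_iff]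
    simpa using hk

/-- The vector space underlying `𝓗₊`: the Dirichlet series that converge somewhere and whose
`𝓗²`-abscissa is at most `0`. -/
def hplusSeries : Submodule ℂ (ℕ+ → ℂ) where
  carrier := {a | ConvergesSomewhere a ∧ h2Abscissa a ≤ 0}
  add_mem' {a b} ha hb := (hplus_iff _).2 (add_mem ((hplus_iff a).1 ha) ((hplus_iff b).1 hb))
  zero_mem' := (hplus_iff _).2 (zero_mem _)
  smul_mem' c a ha := (hplus_iff _).2 (Submodule.smul_mem _ c ((hplus_iff a).1 ha))

lemma hplusSeries_le (k : ℕ+) : hplusSeries ≤ h2kSeries k := fun a ha =>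
  (Submodule.mem_iInf _).1 ((hplus_iff a).1 ha) k

/-- The space `𝓗₊` of Dirichlet series, with the topology defined by the seminorms
`‖·‖_{2,k}`, `k ≥ 1`. -/
def HPlus : Type := hplusSeries

namespace HPlus

instance : AddCommGroup HPlus := inferInstanceAs (AddCommGroup hplusSeries)
instance : Module ℂ HPlus := inferInstanceAs (Module ℂ hplusSeries)

/-- The coefficients of a series in `𝓗₊`. -/
def coeffs : HPlus →ₗ[ℂ] (ℕ+ → ℂ) := hplusSeries.subtype

/-- The inclusion `𝓗₊ ⊆ 𝓗²ₖ`. -/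
def incl (k : ℕ+) : HPlus →ₗ[ℂ] DirichletH2k k := Submodule.inclusion (hplusSeries_le k)

/-- The seminorms `‖·‖_{2,k}` on `𝓗₊`. -/
def seminorms : SeminormFamily ℂ HPlus ℕ+ := fun k => (normSeminorm ℂ (DirichletH2k k)).comp (incl k)

instance : TopologicalSpace HPlus := seminorms.moduleFilterBasis.topology

end HPlus

/-- The sequence `𝔭₁ = 2, 𝔭₂ = 3, …` of the primes; indices start at `0` here. -/
def primeSeq (j : ℕ) : ℕ := Nat.nth Nat.Prime j

lemma primeSeq_pos (j : ℕ) : 0 < primeSeq j :=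
  (Nat.nth_mem_of_infinite Nat.infinite_setOfPred_prime j).pos

/-- The weight `𝔭ⱼ^{1/k}`. -/
def weight (k : ℕ+) (j : ℕ) : ℝ := (primeSeq j : ℝ) ^ (1 / (k : ℝ))

lemma weight_pos (k : ℕ+) (j : ℕ) : 0 < weight k j :=
  Real.rpow_pos_of_pos (Nat.cast_pos.2 (primeSeq_pos j)) _

/-- The number `𝔭^α = ∏ 𝔭ⱼ^{αⱼ}`. -/
def primePow (α : ℕ →₀ ℕ) : ℕ+ :=
  ⟨α.prod fun j m => primeSeq j ^ m, Finset.prod_pos fun j _ => pow_pos (primeSeq_pos j) _⟩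

/-- The diagonal map `z ↦ (zⱼ 𝔭ⱼ^{1/k})ⱼ`. -/
def weightMul (k : ℕ+) : (ℕ → ℂ) →ₗ[ℂ] (ℕ → ℂ) where
  toFun z := fun j => z j * weight k j
  map_add' z w := by ext j; simp [add_mul]
  map_smul' c z := by ext j; simp [mul_assoc]

lemma weightMul_injective (k : ℕ+) : Function.Injective (weightMul k) := by
  intro z w h
  ext j
  have : (weight k j : ℂ) ≠ 0 := by exact_mod_cast (weight_pos k j).ne'
  exact mul_right_cancel₀ this (congrFun h j)

/-- The vector space underlying `ℓ₂(𝔭^{1/k})`. -/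
def wl2 (k : ℕ+) : Submodule ℂ (ℕ → ℂ) where
  carrier := {z | Memℓp (weightMul k z) 2}
  add_mem' {z w} hz hw := by
    change Memℓp (weightMul k (z + w)) 2
    rw [map_add]; exact Memℓp.add hz hw
  zero_mem' := by
    change Memℓp (weightMul k 0) 2
    rw [map_zero]; exact zero_memℓp
  smul_mem' c z hz := by
    change Memℓp (weightMul k (c • z)) 2
    rw [map_smul]; exact Memℓp.const_smul hz c

/-- The Banach sequence space `ℓ₂(𝔭^{1/k})`, with the norm `(∑ |zⱼ 𝔭ⱼ^{1/k}|²)^{1/2}`. -/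
def WeightedL2 (k : ℕ+) : Type := wl2 k

namespace WeightedL2

instance (k : ℕ+) : AddCommGroup (WeightedL2 k) := inferInstanceAs (AddCommGroup (wl2 k))
instance (k : ℕ+) : Module ℂ (WeightedL2 k) := inferInstanceAs (Module ℂ (wl2 k))

/-- The sequence underlying an element of `ℓ₂(𝔭^{1/k})`. -/
def seq (k : ℕ+) : WeightedL2 k →ₗ[ℂ] (ℕ → ℂ) := (wl2 k).subtype

/-- The map `z ↦ (zⱼ 𝔭ⱼ^{1/k})ⱼ` from `ℓ₂(𝔭^{1/k})` to `ℓ₂`, which defines the norm. -/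
def toLp (k : ℕ+) : WeightedL2 k →ₗ[ℂ] lp (fun _ : ℕ => ℂ) 2 where
  toFun z := ⟨weightMul k (seq k z), z.2⟩
  map_add' z w := Subtype.ext (by
    change weightMul k (seq k (z + w)) = weightMul k (seq k z) + weightMul k (seq k w)
    simp only [map_add])
  map_smul' c z := Subtype.ext (by
    change weightMul k (seq k (c • z)) = c • weightMul k (seq k z)
    simp only [map_smul])

lemma toLp_injective (k : ℕ+) : Function.Injective (toLp k) := fun _ _ h =>
  Subtype.ext (weightMul_injective k (congrArg Subtype.val h))

instance (k : ℕ+) : NormedAddCommGroup (WeightedL2 k) :=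
  NormedAddCommGroup.induced (WeightedL2 k) (lp (fun _ : ℕ => ℂ) 2) (toLp k) (toLp_injective k)

instance (k : ℕ+) : NormedSpace ℂ (WeightedL2 k) := NormedSpace.induced ℂ _ _ (toLp k)

end WeightedL2

/-- The open unit ball of `ℓ_∞(𝔭^{1/k})`. -/
def weightedBall (k : ℕ+) : Set (ℕ → ℂ) :=
  {z | BddAbove (Set.range fun j => ‖z j * weight k j‖) ∧ ⨆ j, ‖z j * weight k j‖ < 1}

/-- The domain `ℓ₂(𝔭^{1/k}) ∩ B_{ℓ_∞(𝔭^{1/k})}`. -/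
def Omega (k : ℕ+) : Set (ℕ → ℂ) := wl2 k ∩ weightedBall k

/-- Extension by zero of a function on a set of sequences. -/
def zeroExt {S : Set (ℕ → ℂ)} (f : S → ℂ) : (ℕ → ℂ) → ℂ := Function.extend Subtype.val f 0

/-- Holomorphy: Fréchet differentiability at every point of `Omega k` with respect to the norm of
`ℓ₂(𝔭^{1/k})`, in which `Omega k` is open. -/
def IsHolomorphic (k : ℕ+) (f : Omega k → ℂ) : Prop :=
  ∀ z : WeightedL2 k, WeightedL2.seq k z ∈ Omega k →
    DifferentiableAt ℂ (fun w : WeightedL2 k => zeroExt f (WeightedL2.seq k w)) z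

/-- The embedding `(w₁, …, w_N) ↦ (w₁, …, w_N, 0, 0, …)`. -/
def padZero (N : ℕ) : (Fin N → ℂ) →ₗ[ℂ] (ℕ → ℂ) where
  toFun w := fun j => if h : j < N then w ⟨j, h⟩ else 0
  map_add' v w := by ext j; by_cases h : j < N <;> simp [h]
  map_smul' c w := by ext j; by_cases h : j < N <;> simp [h]

/-- The function `(z₁, …, z_N) ↦ f(r₁ z₁, …, r_N z_N, 0, 0, …)` on `𝕋^N`, where `𝕋` is
parametrized by `ℝ / ℤ` through `t ↦ e^{2π i t}`. -/
def onTorus {S : Set (ℕ → ℂ)} (f : S → ℂ) (N : ℕ) (r : Fin N → ℝ) (t : Fin N → UnitAddCircle) : ℂ :=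
  zeroExt f (padZero N fun j => (r j : ℂ) * ((t j).toCircle : ℂ))

/-- The norm of `H²(ℓ₂(𝔭^{1/k}) ∩ B_{ℓ_∞(𝔭^{1/k})})` as an extended real number: the supremum over
`N ≥ 1` and `0 < rⱼ < 𝔭ⱼ^{-1/k}` of the `L²`-norms of `(z₁, …, z_N) ↦ f(r₁ z₁, …, r_N z_N, 0, …)`
with respect to the normalized Lebesgue measure of `𝕋^N`. -/
def hardyENorm (k : ℕ+) (f : Omega k → ℂ) : ℝ≥0∞ :=
  ⨆ (N : ℕ) (_ : 1 ≤ N) (r : Fin N → ℝ) (_ : ∀ j, 0 < r j ∧ r j < (weight k j)⁻¹),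
    eLpNorm (onTorus f N r) 2 (Measure.pi fun _ : Fin N => AddCircle.haarAddCircle)

lemma zeroExt_apply {S : Set (ℕ → ℂ)} (f : S → ℂ) (z : S) : zeroExt f z = f z :=
  Subtype.val_injective.extend_apply f 0 z

lemma zeroExt_zero {S : Set (ℕ → ℂ)} : zeroExt (0 : S → ℂ) = 0 := by
  unfold zeroExt
  ext z
  by_cases h : ∃ a : S, a.1 = z
  · obtain ⟨a, rfl⟩ := h
    rw [Subtype.val_injective.extend_apply]; rfl
  · rw [Function.extend_apply' _ _ _ h]

lemma zeroExt_add {S : Set (ℕ → ℂ)} (f g : S → ℂ) :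
    zeroExt (f + g) = zeroExt f + zeroExt g := by
  unfold zeroExt
  ext z
  by_cases h : ∃ a : S, a.1 = z
  · obtain ⟨a, rfl⟩ := h
    simp only [Pi.add_apply, Subtype.val_injective.extend_apply]
  · simp only [Pi.add_apply, Function.extend_apply' _ _ _ h, Pi.zero_apply, add_zero]

lemma zeroExt_smul {S : Set (ℕ → ℂ)} (c : ℂ) (f : S → ℂ) :
    zeroExt (c • f) = c • zeroExt f := by
  unfold zeroExt
  ext z
  by_cases h : ∃ a : S, a.1 = z
  · obtain ⟨a, rfl⟩ := h
    simp only [Pi.smul_apply, Subtype.val_injective.extend_apply]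
  · simp only [Pi.smul_apply, Function.extend_apply' _ _ _ h, Pi.zero_apply, smul_zero]

lemma padZero_mem_wl2 (k : ℕ+) {N : ℕ} (w : Fin N → ℂ) : padZero N w ∈ wl2 k := by
  refine (memℓp_zero (Set.Finite.subset (Set.finite_lt_nat N) fun j hj => ?_)).of_exponent_ge
    (by simp)
  by_contra h
  apply hj
  have h' : ¬ j < N := h
  simp [weightMul, padZero, h']

/-- The embedding of `ℂ^N` into `ℓ₂(𝔭^{1/k})`. -/
def padL2 (k : ℕ+) (N : ℕ) : (Fin N → ℂ) →ₗ[ℂ] WeightedL2 k :=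
  (padZero N).codRestrict (wl2 k) (padZero_mem_wl2 k)

lemma seq_padL2 (k : ℕ+) {N : ℕ} (w : Fin N → ℂ) :
    WeightedL2.seq k (padL2 k N w) = padZero N w := rfl

lemma norm_lt_one_of_mem_Omega {k : ℕ+} {z : ℕ → ℂ} (hz : z ∈ Omega k) (j : ℕ) :
    ‖z j * weight k j‖ < 1 :=
  (le_ciSup hz.2.1 j).trans_lt hz.2.2

lemma padZero_mem_Omega {k : ℕ+} {N : ℕ} {w : Fin N → ℂ} (hw : ∀ j, ‖w j * weight k j‖ < 1) :
    padZero N w ∈ Omega k := by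
  obtain ⟨c, hc1, hc0, hc⟩ : ∃ c : ℝ, c < 1 ∧ 0 ≤ c ∧ ∀ j, ‖w j * weight k j‖ ≤ c := by
    rcases isEmpty_or_nonempty (Fin N) with h | h
    · exact ⟨0, by norm_num, le_rfl, fun j => h.elim j⟩
    · obtain ⟨i, hi⟩ := Finite.exists_max fun j => ‖w j * weight k j‖
      exact ⟨_, hw i, norm_nonneg _, hi⟩
  have hb : ∀ j, ‖padZero N w j * weight k j‖ ≤ c := by
    intro j
    by_cases h : j < N
    · simpa [padZero, h] using hc ⟨j, h⟩
    · simpa [padZero, h] using hc0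
  exact ⟨padZero_mem_wl2 k w, ⟨c, Set.forall_mem_range.2 hb⟩, (ciSup_le hb).trans_lt hc1⟩

lemma onTorus_mem {k : ℕ+} {N : ℕ} {r : Fin N → ℝ} (hr : ∀ j, 0 < r j ∧ r j < (weight k j)⁻¹)
    (t : Fin N → UnitAddCircle) :
    padZero N (fun j => (r j : ℂ) * ((t j).toCircle : ℂ)) ∈ Omega k := by
  refine padZero_mem_Omega fun j => ?_
  rw [norm_mul, norm_mul, Complex.norm_real, Complex.norm_real, Circle.norm_coe,
    Real.norm_of_nonneg (hr j).1.le, Real.norm_of_nonneg (weight_pos k j).le, mul_one]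
  have := (hr j).2
  rwa [← one_div, lt_div_iff₀ (weight_pos k j)] at this

lemma continuous_onTorus {k : ℕ+} {f : Omega k → ℂ} (hf : IsHolomorphic k f) {N : ℕ}
    {r : Fin N → ℝ} (hr : ∀ j, 0 < r j ∧ r j < (weight k j)⁻¹) : Continuous (onTorus f N r) := by
  have h1 : Continuous fun t : Fin N → UnitAddCircle =>
      padL2 k N (fun j => (r j : ℂ) * ((t j).toCircle : ℂ)) := by
    refine (LinearMap.continuous_of_finiteDimensional (padL2 k N)).comp ?_
    refine continuous_pi fun j => continuous_const.mul ?_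
    exact continuous_subtype_val.comp (AddCircle.continuous_toCircle.comp (continuous_apply j))
  refine continuous_iff_continuousAt.2 fun t => ?_
  have hm : WeightedL2.seq k (padL2 k N (fun j => (r j : ℂ) * ((t j).toCircle : ℂ))) ∈ Omega k := by
    rw [seq_padL2]; exact onTorus_mem hr t
  have h2 : ContinuousAt (fun w : WeightedL2 k => zeroExt f (WeightedL2.seq k w))
      (padL2 k N (fun j => (r j : ℂ) * ((t j).toCircle : ℂ))) :=
    (hf _ hm).continuousAt
  have h3 := h2.tendsto.comp (h1.tendsto t)
  exact h3

lemma hardyENorm_zero (k : ℕ+) : hardyENorm k 0 = 0 := by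
  have : ∀ (N : ℕ) (r : Fin N → ℝ), onTorus (0 : Omega k → ℂ) N r = 0 := by
    intro N r; ext t; simp [onTorus, zeroExt_zero]
  simp [hardyENorm, this]

lemma hardyENorm_add_le {k : ℕ+} {f g : Omega k → ℂ} (hf : IsHolomorphic k f)
    (hg : IsHolomorphic k g) : hardyENorm k (f + g) ≤ hardyENorm k f + hardyENorm k g := by
  refine iSup₂_le fun N hN => iSup₂_le fun r hr => ?_
  have : onTorus (f + g) N r = onTorus f N r + onTorus g N r := by
    ext t; simp [onTorus, zeroExt_add]
  rw [this]
  refine (eLpNorm_add_le (continuous_onTorus hf hr).aestronglyMeasurable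
    (continuous_onTorus hg hr).aestronglyMeasurable (by norm_num)).trans ?_
  gcongr
  · exact le_iSup₂_of_le N hN (le_iSup₂_of_le r hr le_rfl)
  · exact le_iSup₂_of_le N hN (le_iSup₂_of_le r hr le_rfl)

lemma hardyENorm_smul {k : ℕ+} (c : ℂ) (f : Omega k → ℂ) :
    hardyENorm k (c • f) = ‖c‖ₑ * hardyENorm k f := by
  have : ∀ (N : ℕ) (r : Fin N → ℝ), onTorus (c • f) N r = c • onTorus f N r := by
    intro N r; ext t; simp [onTorus, zeroExt_smul]
  simp only [hardyENorm, this, eLpNorm_const_smul, ENNReal.mul_iSup]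

lemma zeroExt_eq_zero_aux {k : ℕ+} {f : Omega k → ℂ} (hf : IsHolomorphic k f)
    (h : hardyENorm k f = 0) {N : ℕ} (hN : 1 ≤ N) {w : Fin N → ℂ}
    (hw : ∀ j, ‖w j * weight k j‖ < 1) (hw0 : ∀ j, w j ≠ 0) : zeroExt f (padZero N w) = 0 := by
  have hr : ∀ j, 0 < ‖w j‖ ∧ ‖w j‖ < (weight k j)⁻¹ := by
    intro j
    refine ⟨norm_pos_iff.2 (hw0 j), ?_⟩
    rw [← one_div, lt_div_iff₀ (weight_pos k j)]
    simpa [abs_of_pos (weight_pos k j)] using hw j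
  have hle : eLpNorm (onTorus f N fun j => ‖w j‖) 2
      (Measure.pi fun _ : Fin N => AddCircle.haarAddCircle) ≤ hardyENorm k f :=
    le_iSup₂_of_le N hN (le_iSup₂_of_le (fun j => ‖w j‖) hr le_rfl)
  rw [h, nonpos_iff_eq_zero, eLpNorm_eq_zero_iff
    (continuous_onTorus hf hr).aestronglyMeasurable (by norm_num),
    (continuous_onTorus hf hr).ae_eq_iff_eq _ continuous_zero] at hle
  have hsurj : ∀ j, ∃ t : UnitAddCircle, (‖w j‖ : ℂ) * (t.toCircle : ℂ) = w j := by
    intro j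
    refine ⟨((Complex.arg (w j) / (2 * Real.pi) : ℝ) : UnitAddCircle), ?_⟩
    rw [AddCircle.toCircle_apply_mk, Circle.coe_exp]
    have : 2 * Real.pi / 1 * (Complex.arg (w j) / (2 * Real.pi)) = Complex.arg (w j) := by
      field_simp
    rw [this]
    exact Complex.norm_mul_exp_arg_mul_I (w j)
  choose t ht using hsurj
  have := congrFun hle t
  simpa [onTorus, ht] using this

lemma zeroExt_padZero_eq_zero {k : ℕ+} {f : Omega k → ℂ} (hf : IsHolomorphic k f)
    (h : hardyENorm k f = 0) {N : ℕ} (hN : 1 ≤ N) {w : Fin N → ℂ}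
    (hw : ∀ j, ‖w j * weight k j‖ < 1) : zeroExt f (padZero N w) = 0 := by
  set u : Fin N → ℂ := fun j => if w j = 0 then 1 else 0 with hu
  have hlin : Tendsto (fun ε : ℝ => w + (ε : ℂ) • u) (𝓝[>] 0) (𝓝 w) := by
    have : Continuous fun ε : ℝ => w + (ε : ℂ) • u := by fun_prop
    simpa using (this.tendsto 0).mono_left nhdsWithin_le_nhds
  have hm : WeightedL2.seq k (padL2 k N w) ∈ Omega k := by
    rw [seq_padL2]; exact padZero_mem_Omega hw
  have ht := (hf (padL2 k N w) hm).continuousAt.tendsto.comp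
    (((LinearMap.continuous_of_finiteDimensional (padL2 k N)).tendsto w).comp hlin)
  refine tendsto_nhds_unique ht (tendsto_const_nhds.congr' ?_)
  have hev : ∀ᶠ v in 𝓝 w, ∀ j : Fin N, ‖(v j : ℂ) * (weight k j : ℂ)‖ < 1 := by
    rw [eventually_all]
    intro j
    have : Continuous fun v : Fin N → ℂ => ‖v j * weight k j‖ := by fun_prop
    exact (this.tendsto w).eventually_lt_const (hw j)
  filter_upwards [hlin.eventually hev, self_mem_nhdsWithin] with ε hε hε0
  refine (zeroExt_eq_zero_aux hf h hN hε fun j => ?_).symm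
  have : (ε : ℂ) ≠ 0 := by exact_mod_cast (ne_of_gt hε0)
  by_cases hj : w j = 0 <;> simp [hu, hj, this]

lemma eq_zero_of_hardyENorm_eq_zero {k : ℕ+} {f : Omega k → ℂ} (hf : IsHolomorphic k f)
    (h : hardyENorm k f = 0) : f = 0 := by
  ext ⟨z, hz⟩
  have h3 : Tendsto (fun N : ℕ => padL2 k N fun j => z j) atTop
      (𝓝 (show WeightedL2 k from ⟨z, hz.1⟩)) := by
    have hind : IsInducing (WeightedL2.toLp k) := ⟨rfl⟩
    rw [hind.tendsto_nhds_iff]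
    have hs := (lp.hasSum_single (by simp)
      (WeightedL2.toLp k (show WeightedL2 k from ⟨z, hz.1⟩))).tendsto_sum_nat
    refine hs.congr fun N => ?_
    ext i
    rw [lp.coeFn_sum, Finset.sum_apply]
    change _ = padZero N (fun j => z j) i * weight k i
    simp only [lp.single_apply, Pi.single_apply]
    rw [Finset.sum_ite_eq (Finset.range N) i]
    by_cases hi : i < N
    · simp only [Finset.mem_range, hi, if_true, padZero]
      simp [hi]; rfl
    · simp [padZero, hi]
  have hm := hf (show WeightedL2 k from ⟨z, hz.1⟩) hz
  have h4 := hm.continuousAt.tendsto.comp h3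
  have h5 : zeroExt f z = 0 := by
    refine tendsto_nhds_unique h4 (tendsto_const_nhds.congr' ?_)
    filter_upwards [eventually_ge_atTop 1] with N hN
    exact (zeroExt_padZero_eq_zero hf h hN fun j => norm_lt_one_of_mem_Omega hz j).symm
  rw [← zeroExt_apply f ⟨z, hz⟩]
  exact h5

/-- The vector space underlying `H²(ℓ₂(𝔭^{1/k}) ∩ B_{ℓ_∞(𝔭^{1/k})})`. -/
def hardyFunctions (k : ℕ+) : Submodule ℂ (Omega k → ℂ) where
  carrier := {f | IsHolomorphic k f ∧ hardyENorm k f < ∞}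
  add_mem' {f g} hf hg := by
    refine ⟨fun z hz => ?_, (hardyENorm_add_le hf.1 hg.1).trans_lt (ENNReal.add_lt_top.2 ⟨hf.2, hg.2⟩)⟩
    rw [zeroExt_add]
    exact (hf.1 z hz).add (hg.1 z hz)
  zero_mem' := by
    refine ⟨fun z _ => ?_, by rw [hardyENorm_zero]; simp⟩
    rw [zeroExt_zero]
    exact differentiableAt_const 0
  smul_mem' c f hf := by
    refine ⟨fun z hz => ?_, by
      rw [hardyENorm_smul]; exact ENNReal.mul_lt_top enorm_lt_top hf.2⟩
    rw [zeroExt_smul]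
    exact (hf.1 z hz).const_smul c

/-- The Hardy space `H²(ℓ₂(𝔭^{1/k}) ∩ B_{ℓ_∞(𝔭^{1/k})})` of holomorphic functions. -/
def HardyH2 (k : ℕ+) : Type := hardyFunctions k

namespace HardyH2

instance (k : ℕ+) : AddCommGroup (HardyH2 k) := inferInstanceAs (AddCommGroup (hardyFunctions k))
instance (k : ℕ+) : Module ℂ (HardyH2 k) := inferInstanceAs (Module ℂ (hardyFunctions k))

/-- The function underlying an element of the Hardy space. -/
def toFun (k : ℕ+) : HardyH2 k →ₗ[ℂ] (Omega k → ℂ) := (hardyFunctions k).subtype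

instance (k : ℕ+) : Norm (HardyH2 k) := ⟨fun f => (hardyENorm k (toFun k f)).toReal⟩

lemma normCore (k : ℕ+) : NormedSpace.Core ℂ (HardyH2 k) where
  norm_nonneg f := ENNReal.toReal_nonneg
  norm_smul c f := by
    change (hardyENorm k (toFun k (c • f))).toReal = ‖c‖ * (hardyENorm k (toFun k f)).toReal
    rw [map_smul, hardyENorm_smul, ENNReal.toReal_mul, toReal_enorm]
  norm_triangle f g := by
    change (hardyENorm k (toFun k (f + g))).toReal ≤
      (hardyENorm k (toFun k f)).toReal + (hardyENorm k (toFun k g)).toReal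
    have hf : hardyENorm k (toFun k f) < ∞ := f.2.2
    have hg : hardyENorm k (toFun k g) < ∞ := g.2.2
    rw [map_add, ← ENNReal.toReal_add hf.ne hg.ne]
    exact ENNReal.toReal_mono (ENNReal.add_lt_top.2 ⟨hf, hg⟩).ne
      (hardyENorm_add_le f.2.1 g.2.1)
  norm_eq_zero_iff f := by
    change (hardyENorm k (toFun k f)).toReal = 0 ↔ f = 0
    constructor
    · intro h
      exact Subtype.ext (eq_zero_of_hardyENorm_eq_zero f.2.1
        (((ENNReal.toReal_eq_zero_iff _).1 h).resolve_right f.2.2.ne))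
    · rintro rfl
      rw [map_zero, hardyENorm_zero, ENNReal.toReal_zero]

instance (k : ℕ+) : NormedAddCommGroup (HardyH2 k) := NormedAddCommGroup.ofCore (normCore k)
instance (k : ℕ+) : NormedSpace ℂ (HardyH2 k) := NormedSpace.ofCore (normCore k)

end HardyH2

/-- `c` is the family of monomial coefficients of `f`: for every `N` the restriction of `f` to
`Omega k ∩ ℂ^N` has the power series expansion `f(z) = ∑_α c_α z^α`. (At a point of `ℂ^N` the terms
of multi-indices that involve further variables are zero.) -/
def HasMonomialCoeffs {k : ℕ+} (f : Omega k → ℂ) (c : (ℕ →₀ ℕ) → ℂ) : Prop :=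
  ∀ (N : ℕ) (z : Omega k), (∀ j, N ≤ j → (z : ℕ → ℂ) j = 0) →
    HasSum (fun α : ℕ →₀ ℕ => c α * α.prod fun j m => (z : ℕ → ℂ) j ^ m) (f z)

/-- The restriction to `Omega k` of a function on the union of all these domains. -/
def restrictOmega (k : ℕ+) : ((⋃ i : ℕ+, Omega i : Set (ℕ → ℂ)) → ℂ) →ₗ[ℂ] (Omega k → ℂ) where
  toFun f := fun z => f ⟨z, Set.mem_iUnion.2 ⟨k, z.2⟩⟩
  map_add' _ _ := rfl
  map_smul' _ _ := rfl

/-- The intersection of the Hardy spaces: the functions on the union of the (increasing) domains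
`Omega k` whose restriction to each `Omega k` belongs to `HardyH2 k`. -/
def hardyInterFunctions : Submodule ℂ ((⋃ i : ℕ+, Omega i : Set (ℕ → ℂ)) → ℂ) :=
  ⨅ k : ℕ+, (hardyFunctions k).comap (restrictOmega k)

/-- The intersection of the Hardy spaces, with the topology of the projective limit. -/
def HardyInter : Type := hardyInterFunctions

namespace HardyInter

instance : AddCommGroup HardyInter := inferInstanceAs (AddCommGroup hardyInterFunctions)
instance : Module ℂ HardyInter := inferInstanceAs (Module ℂ hardyInterFunctions)

/-- The canonical map of the intersection into the `k`-th Hardy space. -/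
def toHardy (k : ℕ+) : HardyInter →ₗ[ℂ] HardyH2 k :=
  (restrictOmega k).restrict (p := hardyInterFunctions) (q := hardyFunctions k) fun _ hf =>
    (Submodule.mem_iInf _).1 hf k

/-- The topology of the projective limit: the coarsest one for which the maps `toHardy k` are
continuous. -/
instance : TopologicalSpace HardyInter :=
  ⨅ k : ℕ+, TopologicalSpace.induced (toHardy k) inferInstance

end HardyInter

end

/-! Both kinds of space are weighted copies of `ℓ²`, and the weights agree. By unique factorization
`α ↦ 𝔭^α` enumerates the positive integers, and `(𝔭^α)^{1/k} = ∏ (𝔭ⱼ^{1/k})^{αⱼ}`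
(`primePow_bijective`, `primePow_rpow`). So the norm of `𝓗²ₖ` is the `ℓ²`-norm of the numbers
`a_{𝔭^α} / ∏ (𝔭ⱼ^{1/k})^{αⱼ}`, which are the `scaledCoeff`s.

On the function side, Parseval's identity on each torus, together with a limit in which the radii
tend to `𝔭ⱼ^{-1/k}`, shows that the Hardy norm is the same `ℓ²`-norm of the scaled monomial
coefficients (`HasMonomialCoeffs.hardyENorm_eq`). The coefficients exist because a holomorphic
function on a finite-dimensional polydisc has a power series (`exists_hasSum_polydisc`) and the
expansions in different dimensions agree by uniqueness.

Conversely, square summable scaled coefficients define a function on `Omega k`: by Cauchy-Schwarz it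
suffices that `∑_α |∏ (zⱼ𝔭ⱼ^{1/k})^{αⱼ}|² = ∏ⱼ (1 - |zⱼ𝔭ⱼ^{1/k}|²)⁻¹` is finite, which uses both the
`ℓ₂` and the `ℓ_∞` condition. The bound is locally uniform, so the sum is holomorphic
(`isHolomorphic_monomialSum`). A function in the Hardy space equals the sum of its series because
the difference has norm zero (`exists_eq_monomialSum`).

For (ii), `𝓗₊` is the intersection of the `𝓗²ₖ`. The coefficients of a function in the intersection
do not depend on `k`, since all the domains contain `Omega 1`. Both topologies are initial for the
maps to the `k`-th spaces, which are isometric to each other. -/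

/-! ### Uniform limits of holomorphic functions on a normed space. -/

/-- A uniform limit of holomorphic functions on a ball of a complex normed space is differentiable
at the centre. -/
theorem differentiableAt_of_tendstoUniformlyOn_ball {E ι : Type*} [NormedAddCommGroup E]
    [NormedSpace ℂ E] {l : Filter ι} [l.NeBot] {F : ι → E → ℂ} {g : E → ℂ} {c : E} {R : ℝ}
    (hR : 0 < R) (hF : ∀ n, DifferentiableOn ℂ (F n) (Metric.ball c R))
    (h : TendstoUniformlyOn F g l (Metric.ball c R)) : DifferentiableAt ℂ g c := by
  set s := Metric.ball c (R / 2) with hs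
  have hball : ∀ x ∈ s, Metric.ball x (R / 2) ⊆ Metric.ball c R := fun x hx =>
    Metric.ball_subset_ball' (by have := Metric.mem_ball.1 hx; linarith)
  have hsub : s ⊆ Metric.ball c R := Metric.ball_subset_ball (by linarith)
  have hd : ∀ n, ∀ x ∈ s, DifferentiableAt ℂ (F n) x := fun n x hx =>
    (hF n).differentiableAt (Metric.isOpen_ball.mem_nhds (hsub hx))
  have hc : UniformCauchySeqOn (fun n => fderiv ℂ (F n)) l s := by
    intro u hu
    obtain ⟨ε, hε, hεu⟩ := Metric.mem_uniformity_dist.1 hu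
    -- Cauchy estimate on balls of radius `R / 2`: differences below `ε * R / 8` oscillate by at
    -- most `ε * R / 4` about their central value, so their derivatives are bounded by `ε / 2`.
    filter_upwards [h.uniformCauchySeqOn _ (Metric.dist_mem_uniformity
      (show 0 < ε * R / 8 by positivity))] with m hm x hx
    apply hεu
    have hmaps : Set.MapsTo (F m.1 - F m.2) (Metric.ball x (R / 2))
        (Metric.closedBall ((F m.1 - F m.2) x) (ε * R / 4)) := by
      intro y hy
      have h1 := hm y (hball x hx hy)
      have h2 := hm x (hsub hx)
      simp only [dist_eq_norm] at h1 h2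
      rw [Metric.mem_closedBall, dist_eq_norm]
      have := norm_sub_le ((F m.1 - F m.2) y) ((F m.1 - F m.2) x)
      simp only [Pi.sub_apply] at this ⊢
      linarith
    have hle := Complex.norm_fderiv_le_div_of_mapsTo_ball
      (((hF m.1).sub (hF m.2)).mono (hball x hx)) hmaps (by linarith)
    rw [fderiv_sub (hd _ x hx) (hd _ x hx)] at hle
    rw [dist_eq_norm]
    refine hle.trans_lt ?_
    have : ε * R / 4 / (R / 2) = ε / 2 := by field_simp; norm_num
    linarith
  have hlim : ∀ x ∈ s, ∃ y, Tendsto (fun n => fderiv ℂ (F n) x) l (𝓝 y) := fun x hx =>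
    CompleteSpace.complete (hc.cauchy_map hx)
  choose! g' hg' using hlim
  exact (hasFDerivAt_of_tendstoUniformlyOn Metric.isOpen_ball
    (hc.tendstoUniformlyOn_of_tendsto hg') (fun n x hx => (hd n x hx).hasFDerivAt)
    (fun x hx => h.tendsto_at (hsub hx)) (Metric.mem_ball_self (by linarith))).differentiableAt

/-! ### Multi-indices in finitely many variables and the Euler product bound. -/

/-- The multi-index on `ℕ` that extends a multi-index on `Fin N` by zero. -/
noncomputable def finMultiIndex (N : ℕ) (n : Fin N → ℕ) : ℕ →₀ ℕ :=
  (Finsupp.equivFunOnFinite.symm n).embDomain Fin.valEmbedding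

lemma finMultiIndex_injective (N : ℕ) : Function.Injective (finMultiIndex N) :=
  (Finsupp.embDomain_injective _).comp Finsupp.equivFunOnFinite.symm.injective

lemma finMultiIndex_prod {M : Type*} [CommMonoid M] (N : ℕ) (n : Fin N → ℕ) (x : ℕ → M) :
    ((finMultiIndex N n).prod fun j m => x j ^ m) = ∏ j : Fin N, x j ^ n j := by
  rw [finMultiIndex, Finsupp.prod_embDomain, Finsupp.prod_fintype _ _ (by simp)]
  rfl

lemma mem_range_finMultiIndex {N : ℕ} {α : ℕ →₀ ℕ} :
    α ∈ Set.range (finMultiIndex N) ↔ ∀ j, N ≤ j → α j = 0 := by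
  constructor
  · rintro ⟨n, rfl⟩ j hj
    refine Finsupp.embDomain_of_notMem_range _ _ _ ?_
    rintro ⟨i, rfl⟩
    exact absurd i.2 (not_lt.2 hj)
  · intro h
    refine ⟨fun j => α j, Finsupp.ext fun j => ?_⟩
    by_cases hj : j < N
    · exact Finsupp.embDomain_apply_self Fin.valEmbedding
        (Finsupp.equivFunOnFinite.symm fun j : Fin N => α j) ⟨j, hj⟩
    · rw [h j (by omega)]
      refine Finsupp.embDomain_of_notMem_range _ _ _ ?_
      rintro ⟨i, rfl⟩
      exact hj i.2

lemma exists_forall_mem_range_finMultiIndex (S : Finset (ℕ →₀ ℕ)) :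
    ∃ N, 1 ≤ N ∧ ∀ α ∈ S, α ∈ Set.range (finMultiIndex N) := by
  refine ⟨S.sup (fun α => α.support.sup id) + 1, by omega, fun α hα => ?_⟩
  rw [mem_range_finMultiIndex]
  intro j hj
  by_contra h0
  have h1 : j ≤ α.support.sup id := Finset.le_sup (f := id) (Finsupp.mem_support_iff.2 h0)
  have h2 : α.support.sup id ≤ S.sup (fun α => α.support.sup id) :=
    Finset.le_sup (f := fun α : ℕ →₀ ℕ => α.support.sup id) hα
  omega

/-- Finitely many multi-indices involve only finitely many variables. The condition `1 ≤ N` matches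
the range of the supremum in `hardyENorm`. -/
lemma exists_eq_map_finMultiIndex (S : Finset (ℕ →₀ ℕ)) :
    ∃ N, 1 ≤ N ∧ ∃ T : Finset (Fin N → ℕ),
      S = T.map ⟨finMultiIndex N, finMultiIndex_injective N⟩ := by
  classical
  obtain ⟨N, hN1, hN⟩ := exists_forall_mem_range_finMultiIndex S
  refine ⟨N, hN1, S.preimage (finMultiIndex N) (finMultiIndex_injective N).injOn, ?_⟩
  rw [Finset.map_eq_image, Function.Embedding.coeFn_mk, Finset.image_preimage]
  exact (Finset.filter_true_of_mem hN).symm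

/-- Finite sums of monomials in nonnegative variables are bounded by the Euler product. -/
lemma sum_monomial_le_exp {x : ℕ → ℝ} {ρ : ℝ} (h0 : ∀ j, 0 ≤ x j) (hx : ∀ j, x j ≤ ρ) (hρ : ρ < 1)
    (hs : Summable x) (S : Finset (ℕ →₀ ℕ)) :
    ∑ α ∈ S, (α.prod fun j m => x j ^ m) ≤ Real.exp ((∑' j, x j) / (1 - ρ)) := by
  obtain ⟨N, -, T, rfl⟩ := exists_eq_map_finMultiIndex S
  rw [Finset.sum_map]
  simp only [Function.Embedding.coeFn_mk, finMultiIndex_prod]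
  -- Enlarging `T` to a full cube of exponents makes the sum factor into truncated geometric series.
  obtain ⟨M, hM⟩ : ∃ M, T ⊆ Fintype.piFinset fun _ : Fin N => Finset.range M := by
    refine ⟨T.sup (fun n => Finset.univ.sup n) + 1, fun n hn => ?_⟩
    rw [Fintype.mem_piFinset]
    intro j
    have h1 : n j ≤ Finset.univ.sup n := Finset.le_sup (Finset.mem_univ j)
    have h2 : Finset.univ.sup n ≤ T.sup (fun n => Finset.univ.sup n) :=
      Finset.le_sup (f := fun n : Fin N → ℕ => Finset.univ.sup n) hn
    rw [Finset.mem_range]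
    omega
  -- From `(1 - x)⁻¹ = 1 + x / (1 - x) ≤ 1 + x / (1 - ρ) ≤ exp (x / (1 - ρ))`; exponentials turn the
  -- product over `j` into the sum of the `x j`.
  have hfac : ∀ j, ∑ m ∈ Finset.range M, x j ^ m ≤ Real.exp (x j / (1 - ρ)) := by
    intro j
    have hxj : x j < 1 := (hx j).trans_lt hρ
    have h1 : ∑ m ∈ Finset.range M, x j ^ m ≤ (1 - x j)⁻¹ := by
      rw [← tsum_geometric_of_lt_one (h0 j) hxj]
      exact (summable_geometric_of_lt_one (h0 j) hxj).sum_le_tsum _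
        fun m _ => pow_nonneg (h0 j) m
    refine h1.trans ?_
    have h2 : (1 - x j)⁻¹ = 1 + x j / (1 - x j) := by
      have : 1 - x j ≠ 0 := by linarith
      field_simp
      ring
    have h3 : x j / (1 - x j) ≤ x j / (1 - ρ) :=
      div_le_div_of_nonneg_left (h0 j) (by linarith) (by linarith [hx j])
    have := Real.add_one_le_exp (x j / (1 - ρ))
    linarith
  calc ∑ n ∈ T, ∏ j : Fin N, x j ^ n j
      ≤ ∑ n ∈ Fintype.piFinset fun _ : Fin N => Finset.range M, ∏ j : Fin N, x j ^ n j :=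
        Finset.sum_le_sum_of_subset_of_nonneg hM fun n _ _ =>
          Finset.prod_nonneg fun j _ => pow_nonneg (h0 j) _
    _ = ∏ j : Fin N, ∑ m ∈ Finset.range M, x j ^ m := (Finset.prod_univ_sum _ _).symm
    _ ≤ ∏ j : Fin N, Real.exp (x j / (1 - ρ)) := Finset.prod_le_prod
        (fun j _ => Finset.sum_nonneg fun m _ => pow_nonneg (h0 j) m) fun j _ => hfac j
    _ = Real.exp (∑ j : Fin N, x j / (1 - ρ)) := (Real.exp_sum _ _).symm
    _ ≤ Real.exp ((∑' j, x j) / (1 - ρ)) := by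
        rw [Real.exp_le_exp, ← Finset.sum_div, Fin.sum_univ_eq_sum_range (fun j => x j)]
        exact div_le_div_of_nonneg_right (hs.sum_le_tsum _ fun j _ => h0 j) (by linarith)

/-! ### Multi-indices and prime factorization. -/

lemma primeSeq_prime (j : ℕ) : (primeSeq j).Prime :=
  Nat.nth_mem_of_infinite Nat.infinite_setOfPred_prime j

/-- The enumeration of the primes as an embedding. -/
noncomputable def primeSeqEmbedding : ℕ ↪ ℕ :=
  ⟨primeSeq, Nat.nth_injective Nat.infinite_setOfPred_prime⟩

lemma coe_primePow (α : ℕ →₀ ℕ) :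
    (primePow α : ℕ) = (α.embDomain primeSeqEmbedding).prod (· ^ ·) := by
  rw [Finsupp.prod_embDomain]
  rfl

lemma prime_of_mem_support_embDomain {α : ℕ →₀ ℕ} {p : ℕ}
    (hp : p ∈ (α.embDomain primeSeqEmbedding).support) : p.Prime := by
  rw [Finsupp.support_embDomain, Finset.mem_map] at hp
  obtain ⟨j, -, rfl⟩ := hp
  exact primeSeq_prime j

/-- Unique factorization: moved along the enumeration of the primes, `α` becomes the factorization
of `primePow α`. -/
lemma primePow_bijective : Function.Bijective primePow := by
  constructor
  · intro α β h
    have h' := congrArg (fun n : ℕ+ => (n : ℕ).factorization) h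
    simp only [coe_primePow] at h'
    rw [Nat.prod_pow_factorization_eq_self fun p hp => prime_of_mem_support_embDomain hp,
      Nat.prod_pow_factorization_eq_self fun p hp => prime_of_mem_support_embDomain hp] at h'
    exact Finsupp.embDomain_injective _ h'
  · intro n
    have hr : ∀ p ∈ (n : ℕ).factorization.support, p ∈ Set.range primeSeqEmbedding := by
      intro p hp
      obtain ⟨j, hj⟩ := (Nat.range_nth_of_infinite Nat.infinite_setOfPred_prime).ge
        (show p ∈ {p | p.Prime} from Nat.prime_of_mem_primeFactors hp)
      exact ⟨j, hj⟩
    refine ⟨(n : ℕ).factorization.comapDomain primeSeqEmbedding primeSeqEmbedding.injective.injOn,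
      PNat.eq ?_⟩
    rw [coe_primePow]
    have : (((n : ℕ).factorization.comapDomain primeSeqEmbedding
        primeSeqEmbedding.injective.injOn).embDomain primeSeqEmbedding) =
        (n : ℕ).factorization :=
      Finsupp.embDomain_comapDomain fun p hp => hr p hp
    rw [this]
    exact Nat.prod_factorization_pow_eq_self n.ne_zero

/-- This is where the arithmetic weights `n^{1/k}` of `𝓗²ₖ` meet the geometric weights of `Omega k`.
-/
lemma primePow_rpow (k : ℕ+) (α : ℕ →₀ ℕ) :
    ((primePow α : ℕ) : ℝ) ^ (1 / (k : ℝ)) = α.prod fun j m => weight k j ^ m := by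
  change ((α.prod fun j m => primeSeq j ^ m : ℕ) : ℝ) ^ (1 / (k : ℝ)) = _
  rw [Finsupp.prod, Nat.cast_prod, ← Real.finsetProd_rpow _ _ fun j _ => by positivity]
  refine Finset.prod_congr rfl fun j _ => ?_
  simp only [weight]
  rw [Nat.cast_pow, ← Real.rpow_natCast, ← Real.rpow_natCast, ← Real.rpow_mul (by positivity),
    ← Real.rpow_mul (by positivity), mul_comm]

/-! ### Absolutely summable trigonometric series on the torus. -/

/-- The normalized Lebesgue measure of the torus. -/
noncomputable abbrev torusMeasure (N : ℕ) : Measure (UnitAddTorus (Fin N)) :=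
  Measure.pi fun _ : Fin N => AddCircle.haarAddCircle

section TrigonometricSeries

variable {N : ℕ} {ι : Type*} {e : ι → Fin N → ℤ} {a : ι → ℂ} {F : UnitAddTorus (Fin N) → ℂ}

/-- An absolutely summable trigonometric series converges in `C(𝕋^N)`. -/
lemma exists_hasSum_mFourier (ha : Summable fun i => ‖a i‖)
    (hF : ∀ t, HasSum (fun i => a i * UnitAddTorus.mFourier (e i) t) (F t)) :
    ∃ G : C(UnitAddTorus (Fin N), ℂ), ⇑G = F ∧
      HasSum (fun i => a i • UnitAddTorus.mFourier (e i)) G := by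
  have hs : Summable fun i => a i • UnitAddTorus.mFourier (e i) := by
    refine .of_norm ?_
    simpa only [norm_smul, UnitAddTorus.mFourier_norm, mul_one] using ha
  refine ⟨_, funext fun t => ?_, hs.hasSum⟩
  exact ((ContinuousMap.evalCLM ℂ t).hasSum hs.hasSum).unique (hF t)

lemma orthonormal_toLp_mFourier (N : ℕ) : Orthonormal ℂ fun n : Fin N → ℤ =>
    ContinuousMap.toLp 2 (torusMeasure N) ℂ (UnitAddTorus.mFourier n) :=
  UnitAddTorus.orthonormal_mFourier

/-- Written as an inner product, a Fourier coefficient can be taken termwise in a convergent series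
by continuity. -/
lemma mFourierCoeff_eq_inner (G : C(UnitAddTorus (Fin N), ℂ)) (n : Fin N → ℤ) :
    UnitAddTorus.mFourierCoeff G n =
      inner ℂ (ContinuousMap.toLp 2 (torusMeasure N) ℂ (UnitAddTorus.mFourier n))
        (ContinuousMap.toLp 2 (torusMeasure N) ℂ G) := by
  have h1 := UnitAddTorus.mFourierCoeff_toLp G n
  have h2 := UnitAddTorus.mFourierBasis_repr (ContinuousMap.toLp 2 (torusMeasure N) ℂ G) n
  rw [HilbertBasis.repr_apply_apply, UnitAddTorus.coe_mFourierBasis] at h2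
  exact h1.symm.trans h2.symm

/-- The series converges uniformly, hence in `L²`, and pairing it with one character leaves a single
term by orthonormality; injectivity of `e` excludes repeated characters. -/
lemma mFourierCoeff_of_hasSum (he : Function.Injective e) (ha : Summable fun i => ‖a i‖)
    (hF : ∀ t, HasSum (fun i => a i * UnitAddTorus.mFourier (e i) t) (F t)) (i : ι) :
    UnitAddTorus.mFourierCoeff F (e i) = a i := by
  classical
  obtain ⟨G, rfl, hG⟩ := exists_hasSum_mFourier ha hF
  rw [mFourierCoeff_eq_inner]
  have h1 := (innerSL ℂ (ContinuousMap.toLp 2 (torusMeasure N) ℂ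
    (UnitAddTorus.mFourier (e i)))).hasSum ((ContinuousMap.toLp 2 (torusMeasure N) ℂ).hasSum hG)
  refine h1.unique ?_
  convert! hasSum_ite_eq i (a i) using 2 with j
  simp only [map_smul, smul_eq_mul, innerSL_apply_apply]
  rw [orthonormal_iff_ite.1 (orthonormal_toLp_mFourier N) (e i) (e j)]
  by_cases h : j = i
  · simp [h]
  · rw [if_neg h, if_neg fun h' => h (he h').symm, mul_zero]

/-- Parseval's identity for an absolutely summable trigonometric series. -/
lemma eLpNorm_of_hasSum_mFourier (he : Function.Injective e) (ha : Summable fun i => ‖a i‖)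
    (hF : ∀ t, HasSum (fun i => a i * UnitAddTorus.mFourier (e i) t) (F t)) :
    eLpNorm F 2 (torusMeasure N) = (∑' i, ‖a i‖ₑ ^ 2) ^ (1 / 2 : ℝ) := by
  have hc := mFourierCoeff_of_hasSum he ha hF
  obtain ⟨G, rfl, hG⟩ := exists_hasSum_mFourier ha hF
  simp only [mFourierCoeff_eq_inner] at hc
  set x := ContinuousMap.toLp 2 (torusMeasure N) ℂ G with hx
  have h1 := (innerSL ℂ x).hasSum ((ContinuousMap.toLp 2 (torusMeasure N) ℂ).hasSum hG)
  -- Pair `x` with its own expansion: the `i`-th term is `a i` times its conjugate and the sum is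
  -- `⟪x, x⟫`.
  have h2 : HasSum (fun i => ‖a i‖ ^ 2) (‖x‖ ^ 2) := by
    rw [← Complex.hasSum_ofReal]
    convert! h1 using 1
    · ext i
      simp only [map_smul, smul_eq_mul, innerSL_apply_apply]
      rw [← inner_conj_symm, hc i, Complex.mul_conj, Complex.normSq_eq_norm_sq]
    · change _ = inner ℂ x x
      rw [inner_self_eq_norm_sq_to_K]
      push_cast
      rfl
  have h5 : eLpNorm G 2 (torusMeasure N) = ENNReal.ofReal ‖x‖ := by
    rw [Lp.norm_def, ENNReal.ofReal_toReal (Lp.eLpNorm_ne_top _)]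
    exact eLpNorm_congr_ae (ContinuousMap.coeFn_toLp (torusMeasure N) G).symm
  have h6 : ∑' i, ‖a i‖ₑ ^ 2 = ENNReal.ofReal (‖x‖ ^ 2) := by
    rw [← h2.tsum_eq, ENNReal.ofReal_tsum_of_nonneg (fun i => by positivity) h2.summable]
    refine tsum_congr fun i => ?_
    rw [ENNReal.ofReal_pow (norm_nonneg _), ofReal_norm]
  rw [h5, h6, ENNReal.ofReal_rpow_of_nonneg (by positivity) (by norm_num), ← Real.sqrt_eq_rpow,
    Real.sqrt_sq (norm_nonneg _)]

end TrigonometricSeries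

/-! ### Fourier coefficients on circles in one variable. -/

lemma coe_toCircle_pow (x : UnitAddCircle) (i : ℕ) : (x.toCircle : ℂ) ^ i = fourier (i : ℤ) x := by
  rw [fourier_apply, AddCircle.toCircle_zsmul]
  simp

lemma integral_fourier_mul_fourier (m n : ℤ) :
    ∫ x : UnitAddCircle, fourier (-m) x * fourier n x ∂AddCircle.haarAddCircle =
      if m = n then 1 else 0 := by
  rw [← orthonormal_iff_ite.1 (orthonormal_fourier (T := 1)) m n]
  simp only [ContinuousMap.inner_toLp, fourier_neg]
  congr! 2
  rw [mul_comm]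

/-- The Fourier coefficients of a holomorphic function on the circles around the origin. -/
lemma integral_fourier_mul_holomorphic {h : ℂ → ℂ} {R : ℝ}
    (hh : DifferentiableOn ℂ h (Metric.ball 0 R)) :
    ∃ a : ℤ → ℂ, ∀ s : ℝ, 0 ≤ s → s < R → ∀ m : ℤ,
      ∫ x : UnitAddCircle, fourier (-m) x * h (s * x.toCircle) ∂AddCircle.haarAddCircle =
        if 0 ≤ m then a m * (s : ℂ) ^ m.toNat else 0 := by
  set b : ℕ → ℂ := fun n => (n.factorial : ℂ)⁻¹ * iteratedDeriv n h 0
  have hb : ∀ z ∈ Metric.ball (0 : ℂ) R, HasSum (fun n => b n * z ^ n) (h z) := by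
    intro z hz
    convert! Complex.hasSum_taylorSeries_on_ball hh hz using 2 with n
    simp [b]; ring
  -- The Taylor coefficients serve all radii `s` at once; the values at negative `m` are never used.
  refine ⟨fun m => b m.toNat, fun s hs hsR m => ?_⟩
  have hmem : ∀ x : UnitAddCircle, (s : ℂ) * x.toCircle ∈ Metric.ball (0 : ℂ) R := by
    intro x
    rw [mem_ball_zero_iff, norm_mul, Circle.norm_coe, mul_one, Complex.norm_real,
      Real.norm_of_nonneg hs]
    exact hsR
  -- Convergence at the point `s` of the circle is absolute, and the terms have the same modulus at
  -- every other point of it.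
  have hsum : Summable fun n => ‖b n * (s : ℂ) ^ n‖ := by
    have := (hb s (by simpa [abs_of_nonneg hs] using hsR)).summable.norm
    exact this
  have hcoeff : ∀ i, ∫ x : UnitAddCircle, fourier (-m) x * (b i * ((s : ℂ) * x.toCircle) ^ i)
      ∂AddCircle.haarAddCircle = if m = i then b i * (s : ℂ) ^ i else 0 := by
    intro i
    have : ∀ x : UnitAddCircle, fourier (-m) x * (b i * ((s : ℂ) * x.toCircle) ^ i) =
        b i * (s : ℂ) ^ i * (fourier (-m) x * fourier (i : ℤ) x) := by
      intro x; rw [mul_pow, coe_toCircle_pow]; ring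
    simp_rw [this]
    rw [integral_const_mul, integral_fourier_mul_fourier]
    split_ifs <;> simp
  have hnorm : ∀ i (x : UnitAddCircle), ‖fourier (-m) x * (b i * ((s : ℂ) * x.toCircle) ^ i)‖ =
      ‖b i * (s : ℂ) ^ i‖ := by
    intro i x
    rw [norm_mul, fourier_apply, Circle.norm_coe, one_mul, mul_pow, ← mul_assoc, norm_mul,
      norm_pow (x.toCircle : ℂ), Circle.norm_coe, one_pow, mul_one]
  have hS := hasSum_integral_of_summable_integral_norm (μ := AddCircle.haarAddCircle (T := 1))
    (F := fun i (x : UnitAddCircle) => fourier (-m) x * (b i * ((s : ℂ) * x.toCircle) ^ i))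
    (fun i => by
      refine Continuous.integrable_of_hasCompactSupport ?_ (HasCompactSupport.of_compactSpace _)
      have : Continuous fun x : UnitAddCircle => (x.toCircle : ℂ) :=
        continuous_subtype_val.comp AddCircle.continuous_toCircle
      fun_prop)
    (by simpa only [hnorm, integral_const, probReal_univ, one_smul] using hsum)
  simp only [hcoeff] at hS
  have hT : ∀ x : UnitAddCircle, ∑' i, fourier (-m) x * (b i * ((s : ℂ) * x.toCircle) ^ i) =
      fourier (-m) x * h (s * x.toCircle) := fun x =>
    ((hb _ (hmem x)).mul_left _).tsum_eq
  simp only [hT] at hS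
  refine hS.unique ?_
  split_ifs with hm
  · convert! hasSum_ite_eq m.toNat (b m.toNat * (s : ℂ) ^ m.toNat) using 2 with i
    by_cases hi : m = i
    · simp [hi]
    · rw [if_neg hi, if_neg]
      omega
  · convert! hasSum_zero using 2 with i
    rw [if_neg]
    omega

/-! ### Power series of holomorphic functions on a polydisc. -/

section Polydisc

variable {N : ℕ} {R : Fin N → ℝ} {F : (Fin N → ℂ) → ℂ}

/-- The open polydisc with centre `0` and radii `R`. -/
def polydisc (R : Fin N → ℝ) : Set (Fin N → ℂ) := {z | ∀ j, ‖z j‖ < R j}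

/-- The point of the torus with radii `r` and angles `t`. -/
noncomputable def torusPoint (r : Fin N → ℝ) (t : UnitAddTorus (Fin N)) : Fin N → ℂ :=
  fun j => (r j : ℂ) * ((t j).toCircle : ℂ)

lemma norm_torusPoint {r : Fin N → ℝ} {j : Fin N} (hr : 0 ≤ r j) (t : UnitAddTorus (Fin N)) :
    ‖torusPoint r t j‖ = r j := by
  rw [torusPoint, norm_mul, Circle.norm_coe, mul_one, Complex.norm_real, Real.norm_of_nonneg hr]

lemma torusPoint_mem {r : Fin N → ℝ} (hr : ∀ j, 0 ≤ r j ∧ r j < R j) (t : UnitAddTorus (Fin N)) :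
    torusPoint r t ∈ polydisc R := fun j => by
  rw [norm_torusPoint (hr j).1]
  exact (hr j).2

lemma continuous_torusPoint (r : Fin N → ℝ) : Continuous (torusPoint r) :=
  continuous_pi fun j => continuous_const.mul
    (continuous_subtype_val.comp (AddCircle.continuous_toCircle.comp (continuous_apply j)))

lemma exists_torusPoint_eq (z : Fin N → ℂ) : ∃ t, torusPoint (fun j => ‖z j‖) t = z := by
  have hsurj : ∀ j, ∃ t : UnitAddCircle, (‖z j‖ : ℂ) * (t.toCircle : ℂ) = z j := by
    intro j
    refine ⟨((Complex.arg (z j) / (2 * Real.pi) : ℝ) : UnitAddCircle), ?_⟩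
    rw [AddCircle.toCircle_apply_mk, Circle.coe_exp]
    have : 2 * Real.pi / 1 * (Complex.arg (z j) / (2 * Real.pi)) = Complex.arg (z j) := by
      field_simp
    rw [this]
    exact Complex.norm_mul_exp_arg_mul_I (z j)
  choose t ht using hsurj
  exact ⟨t, funext ht⟩

lemma prod_torusPoint_pow (r : Fin N → ℝ) (t : UnitAddTorus (Fin N)) (n : Fin N → ℕ) :
    ∏ j, torusPoint r t j ^ n j =
      (∏ j, (r j : ℂ) ^ n j) * UnitAddTorus.mFourier (fun j => (n j : ℤ)) t := by
  simp only [torusPoint, mul_pow, Finset.prod_mul_distrib, coe_toCircle_pow]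
  rfl

lemma continuous_comp_torusPoint (hF : DifferentiableOn ℂ F (polydisc R)) {r : Fin N → ℝ}
    (hr : ∀ j, 0 ≤ r j ∧ r j < R j) : Continuous fun t => F (torusPoint r t) :=
  hF.continuousOn.comp_continuous (continuous_torusPoint r) (torusPoint_mem hr)

/-- The Fourier coefficient of the restriction of `F` to the torus with radii `r`. -/
noncomputable def torusCoeff (F : (Fin N → ℂ) → ℂ) (n : Fin N → ℤ) (r : Fin N → ℝ) : ℂ :=
  UnitAddTorus.mFourierCoeff (fun t => F (torusPoint r t)) n

lemma torusCoeff_eq (F : (Fin N → ℂ) → ℂ) (n : Fin N → ℤ) (r : Fin N → ℝ) :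
    torusCoeff F n r = ∫ t, UnitAddTorus.mFourier (-n) t * F (torusPoint r t) ∂torusMeasure N :=
  rfl

lemma norm_torusCoeff_le {n : Fin N → ℤ} {r : Fin N → ℝ} {M : ℝ}
    (hM : ∀ t, ‖F (torusPoint r t)‖ ≤ M) : ‖torusCoeff F n r‖ ≤ M := by
  rw [torusCoeff_eq]
  refine (norm_integral_le_of_norm_le_const (C := M) (Eventually.of_forall fun t => ?_)).trans ?_
  · rw [norm_mul]
    refine (mul_le_mul_of_nonneg_right ((UnitAddTorus.mFourier (-n)).norm_coe_le_norm t)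
      (norm_nonneg _)).trans ?_
    rw [UnitAddTorus.mFourier_norm, one_mul]
    exact hM t
  · simp

/-- The integral over the torus as an integral of averages over the `j`-th circle. -/
lemma integral_torus_eq_integral_average {G : UnitAddTorus (Fin N) → ℂ} (hG : Continuous G)
    (j : Fin N) :
    ∫ t, G t ∂torusMeasure N =
      ∫ t, ∫ x, G (t + Pi.single j x) ∂AddCircle.haarAddCircle ∂torusMeasure N := by
  have hc : Continuous fun p : UnitAddTorus (Fin N) × UnitAddCircle => G (p.1 + Pi.single j p.2) :=
    hG.comp (continuous_fst.add ((continuous_single j).comp continuous_snd))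
  -- After the swap the integral over `t` is invariant under translation by `Pi.single j x`, so
  -- averaging over `x` changes nothing.
  rw [integral_integral_swap
    (hc.integrable_of_hasCompactSupport (HasCompactSupport.of_compactSpace _))]
  simp only [integral_add_right_eq_self, integral_const, probReal_univ, one_smul]

/-- Isolates the `j`-th coordinate as the one-variable point `s * x.toCircle` up to a fixed
rotation, so that the result on circles applies to it. -/
lemma torusPoint_update_add_single (r : Fin N → ℝ) (j : Fin N) (s : ℝ) (t : UnitAddTorus (Fin N))
    (x : UnitAddCircle) :
    torusPoint (Function.update r j s) (t + Pi.single j x) =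
      Function.update (torusPoint r t) j ((s : ℂ) * x.toCircle * (t j).toCircle) := by
  ext i
  by_cases h : i = j
  · subst h
    simp only [torusPoint, Function.update_self, Pi.add_apply, Pi.single_eq_same,
      AddCircle.toCircle_add, Circle.coe_mul]
    ring
  · simp [torusPoint, h]

lemma mFourier_add_single (n : Fin N → ℤ) (j : Fin N) (t : UnitAddTorus (Fin N))
    (x : UnitAddCircle) : UnitAddTorus.mFourier n (t + Pi.single j x) =
      UnitAddTorus.mFourier n t * fourier (n j) x := by
  change ∏ i, fourier (n i) (t i + (Pi.single j x : UnitAddTorus (Fin N)) i) =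
    (∏ i, fourier (n i) (t i)) * _
  have : ∀ i, fourier (n i) (t i + (Pi.single j x : UnitAddTorus (Fin N)) i) =
      fourier (n i) (t i) * (if i = j then fourier (n j) x else 1) := by
    intro i
    by_cases h : i = j
    · subst h
      simp [fourier_apply, AddCircle.toCircle_add]
    · simp [h]
  simp only [this, Finset.prod_mul_distrib, Finset.prod_ite_eq', Finset.mem_univ, if_true]

/-- The dependence of the Fourier coefficients on a single radius. -/
lemma torusCoeff_update (hF : DifferentiableOn ℂ F (polydisc R)) (n : Fin N → ℤ) {r : Fin N → ℝ}
    (hr : ∀ j, 0 ≤ r j ∧ r j < R j) (j : Fin N) {s : ℝ} (hs : 0 ≤ s ∧ s < R j) (hrj : 0 < r j) :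
    torusCoeff F n (Function.update r j s) =
      (if 0 ≤ n j then ((s / r j : ℝ) : ℂ) ^ (n j).toNat else 0) * torusCoeff F n r := by
  have hup : ∀ s : ℝ, 0 ≤ s ∧ s < R j → ∀ i, 0 ≤ Function.update r j s i ∧
      Function.update r j s i < R i := by
    intro s hs i
    by_cases h : i = j
    · subst h; simpa using hs
    · simpa [h] using hr i
  -- The slice of `F` in the `j`-th coordinate, rotated so that `ζ = s * x.toCircle` corresponds to
  -- the angles `t + Pi.single j x`.
  set H : UnitAddTorus (Fin N) → ℂ → ℂ := fun t ζ =>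
    F (Function.update (torusPoint r t) j (ζ * (t j).toCircle)) with hH
  have hHd : ∀ t, DifferentiableOn ℂ (H t) (Metric.ball 0 (R j)) := by
    intro t
    refine hF.comp (f := fun ζ : ℂ => Function.update (torusPoint r t) j (ζ * (t j).toCircle))
      ?_ ?_
    · refine Differentiable.differentiableOn (differentiable_pi.2 fun i => ?_)
      by_cases h : i = j
      · subst h
        simp only [Function.update_self]
        fun_prop
      · simp [h]
    · intro ζ hζ i
      beta_reduce
      by_cases h : i = j
      · subst h
        rw [Function.update_self, norm_mul, Circle.norm_coe, mul_one]
        simpa using hζ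
      · rw [Function.update_of_ne h]
        exact torusPoint_mem hr t i
  choose a ha using fun t => integral_fourier_mul_holomorphic (hHd t)
  have key : ∀ s : ℝ, 0 ≤ s ∧ s < R j → torusCoeff F n (Function.update r j s) =
      ∫ t, UnitAddTorus.mFourier (-n) t *
        (if 0 ≤ n j then a t (n j) * (s : ℂ) ^ (n j).toNat else 0) ∂torusMeasure N := by
    intro s hs
    rw [torusCoeff_eq, integral_torus_eq_integral_average
      (G := fun t => UnitAddTorus.mFourier (-n) t * F (torusPoint (Function.update r j s) t))
      ((UnitAddTorus.mFourier (-n)).continuous.mul (continuous_comp_torusPoint hF (hup s hs))) j]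
    refine integral_congr_ae (Eventually.of_forall fun t => ?_)
    simp only
    rw [← ha t s hs.1 hs.2, ← integral_const_mul]
    refine integral_congr_ae (Eventually.of_forall fun x => ?_)
    simp only
    rw [mFourier_add_single, torusPoint_update_add_single, mul_assoc]
    rfl
  -- Since `a` does not depend on the radius, the integrals for `s` and for `r j` differ by the
  -- constant factor `(s / r j) ^ n j`. Only this constant is pulled out, so no regularity of `t ↦ a
  -- t` is needed.
  have h0 := key (r j) (hr j)
  rw [Function.update_eq_self] at h0
  rw [key s hs, h0, ← integral_const_mul]
  refine integral_congr_ae (Eventually.of_forall fun t => ?_)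
  simp only
  split_ifs with hn
  · have : ((r j : ℝ) : ℂ) ≠ 0 := by exact_mod_cast hrj.ne'
    rw [Complex.ofReal_div, div_pow]
    field_simp
  · simp

/-- The dependence of the Fourier coefficients on the radii. -/
lemma torusCoeff_eq_prod (hF : DifferentiableOn ℂ F (polydisc R)) (n : Fin N → ℤ)
    {r s : Fin N → ℝ} (hr : ∀ j, 0 < r j ∧ r j < R j) (hs : ∀ j, 0 ≤ s j ∧ s j < R j) :
    torusCoeff F n s =
      (∏ j, if 0 ≤ n j then ((s j / r j : ℝ) : ℂ) ^ (n j).toNat else 0) * torusCoeff F n r := by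
  classical
  -- The radii are changed from `r` to `s` one coordinate at a time.
  suffices h : ∀ T : Finset (Fin N), torusCoeff F n (T.piecewise s r) =
      (∏ j ∈ T, if 0 ≤ n j then ((s j / r j : ℝ) : ℂ) ^ (n j).toNat else 0) *
        torusCoeff F n r by
    simpa using h Finset.univ
  intro T
  induction T using Finset.induction_on with
  | empty => simp
  | insert j T hj ih =>
    have hmem : ∀ i, 0 ≤ T.piecewise s r i ∧ T.piecewise s r i < R i := by
      intro i
      by_cases hi : i ∈ T
      · simpa [hi] using hs i
      · simpa [hi] using ⟨(hr i).1.le, (hr i).2⟩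
    have hval : T.piecewise s r j = r j := by simp [hj]
    rw [Finset.piecewise_insert, torusCoeff_update hF n hmem j (hs j) (hval ▸ (hr j).1), ih, hval,
      Finset.prod_insert hj, mul_assoc]

/-- Padding `x` with zeros makes this a case of the Euler product bound. -/
lemma summable_prod_pow {x : Fin N → ℝ} (h0 : ∀ j, 0 ≤ x j) (h1 : ∀ j, x j < 1) :
    Summable fun n : Fin N → ℕ => ∏ j, x j ^ n j := by
  obtain ⟨ρ, hρ0, hρ1, hρ⟩ : ∃ ρ : ℝ, 0 ≤ ρ ∧ ρ < 1 ∧ ∀ j, x j ≤ ρ := by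
    rcases isEmpty_or_nonempty (Fin N) with h | h
    · exact ⟨0, le_rfl, by norm_num, fun j => h.elim j⟩
    · obtain ⟨i, hi⟩ := Finite.exists_max x
      exact ⟨_, h0 i, h1 i, hi⟩
  set y : ℕ → ℝ := fun j => if h : j < N then x ⟨j, h⟩ else 0 with hy
  have hy0 : ∀ j, 0 ≤ y j := fun j => by
    by_cases h : j < N
    · simpa [hy, h] using h0 _
    · simp [hy, h]
  have hyρ : ∀ j, y j ≤ ρ := fun j => by
    by_cases h : j < N
    · simpa [hy, h] using hρ _
    · simpa [hy, h] using hρ0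
  have hsum : Summable y := summable_of_ne_finset_zero (s := Finset.range N) fun j hj => by
    simp only [Finset.mem_range] at hj
    simp [hy, hj]
  have hS : Summable fun α : ℕ →₀ ℕ => α.prod fun j m => y j ^ m :=
    summable_of_sum_le (fun α => Finset.prod_nonneg fun j _ => pow_nonneg (hy0 j) _)
      (sum_monomial_le_exp hy0 hyρ hρ1 hsum)
  refine (hS.comp_injective (finMultiIndex_injective N)).congr fun n => ?_
  rw [Function.comp_apply, finMultiIndex_prod]
  simp [hy]

lemma natCast_comp_injective (N : ℕ) :
    Function.Injective fun (n : Fin N → ℕ) (j : Fin N) => (n j : ℤ) := fun m n h => by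
  ext j
  exact Int.ofNat_inj.1 (congrFun h j)

/-- A holomorphic function on a polydisc has a power series expansion. -/
theorem exists_hasSum_polydisc (hR : ∀ j, 0 < R j) (hF : DifferentiableOn ℂ F (polydisc R)) :
    ∃ c : (Fin N → ℕ) → ℂ, ∀ z ∈ polydisc R, HasSum (fun n => c n * ∏ j, z j ^ n j) (F z) := by
  have hcast := natCast_comp_injective N
  have hnot : ∀ n : Fin N → ℤ, n ∉ Set.range (fun (n : Fin N → ℕ) (j : Fin N) => (n j : ℤ)) →
      ∃ j, ¬ 0 ≤ n j := by
    intro n hn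
    by_contra! h
    exact hn ⟨fun j => (n j).toNat, funext fun j => Int.toNat_of_nonneg (h j)⟩
  -- A reference torus that defines the coefficients independently of `z`.
  set q : Fin N → ℝ := fun j => R j / 2
  have hq : ∀ j, 0 < q j ∧ q j < R j := fun j => ⟨half_pos (hR j), half_lt_self (hR j)⟩
  refine ⟨fun n => torusCoeff F (fun j => n j) q / ∏ j, (q j : ℂ) ^ n j, fun z hz => ?_⟩
  obtain ⟨t, ht⟩ := exists_torusPoint_eq z
  set s : Fin N → ℝ := fun j => ‖z j‖ with hs
  have hsR : ∀ j, 0 ≤ s j ∧ s j < R j := fun j => ⟨norm_nonneg _, hz j⟩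
  -- A slightly larger torus: `F` is bounded on it, so the coefficients on the torus through `z`
  -- decay geometrically with ratios `s j / r j < 1`. Some `s j` may vanish, but the `r j` are
  -- positive.
  choose r hr using fun j => exists_between (hz j)
  have hr0 : ∀ j, 0 < r j ∧ r j < R j := fun j => ⟨(norm_nonneg _).trans_lt (hr j).1, (hr j).2⟩
  have hzero : ∀ n : Fin N → ℤ,
      n ∉ Set.range (fun (n : Fin N → ℕ) (j : Fin N) => (n j : ℤ)) → torusCoeff F n s = 0 := by
    intro n hn
    obtain ⟨j, hj⟩ := hnot n hn
    rw [torusCoeff_eq_prod hF n hq hsR, Finset.prod_eq_zero (Finset.mem_univ j) (if_neg hj),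
      zero_mul]
  have hnat : ∀ {p : Fin N → ℝ}, (∀ j, 0 < p j ∧ p j < R j) → ∀ n : Fin N → ℕ,
      torusCoeff F (fun j => n j) s =
      ((∏ j, (s j / p j) ^ n j : ℝ) : ℂ) * torusCoeff F (fun j => n j) p := by
    intro p hp n
    rw [torusCoeff_eq_prod hF _ hp hsR]
    simp
  obtain ⟨M, hM⟩ : ∃ M, ∀ t, ‖F (torusPoint r t)‖ ≤ M := by
    have := isCompact_range (continuous_comp_torusPoint hF fun j => ⟨(hr0 j).1.le, (hr0 j).2⟩)
    obtain ⟨M, hM⟩ := this.isBounded.exists_norm_le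
    exact ⟨M, fun t => hM _ ⟨t, rfl⟩⟩
  have hsum : Summable fun n => torusCoeff F n s := by
    rw [← hcast.summable_iff hzero]
    refine Summable.of_norm_bounded ((summable_prod_pow (x := fun j => s j / r j)
      (fun j => div_nonneg (hsR j).1 (hr0 j).1.le)
      (fun j => (div_lt_one (hr0 j).1).2 (hr j).1)).mul_right M) fun n => ?_
    rw [Function.comp_apply, hnat hr0, norm_mul, Complex.norm_real, Real.norm_of_nonneg
      (Finset.prod_nonneg fun j _ => pow_nonneg (div_nonneg (hsR j).1 (hr0 j).1.le) _)]
    exact mul_le_mul_of_nonneg_left (norm_torusCoeff_le hM)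
      (Finset.prod_nonneg fun j _ => pow_nonneg (div_nonneg (hsR j).1 (hr0 j).1.le) _)
  -- A continuous function with summable Fourier coefficients is the sum of its Fourier series at
  -- every point; here the coefficients live on `ℕ^N`.
  have hfin := UnitAddTorus.hasSum_mFourier_series_apply_of_summable
    (f := ⟨_, continuous_comp_torusPoint hF hsR⟩) hsum t
  rw [← hcast.hasSum_iff fun n hn => by
    have := hzero n hn
    simp only [torusCoeff] at this
    simp [this]] at hfin
  simp only [ContinuousMap.coe_mk, ht] at hfin
  refine hfin.congr_fun fun n => ?_
  have h1 := hnat hq n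
  have h2 : (∏ j, (q j : ℂ) ^ n j) ≠ 0 :=
    Finset.prod_ne_zero_iff.2 fun j _ => pow_ne_zero _ (by exact_mod_cast (hq j).1.ne')
  simp only [Function.comp_apply, smul_eq_mul]
  change _ = torusCoeff F (fun j => n j) s * _
  rw [h1]
  nth_rw 1 [← ht]
  rw [prod_torusPoint_pow]
  push_cast
  simp only [div_pow, Finset.prod_div_distrib]
  field_simp

end Polydisc

/-! ### Existence and uniqueness of monomial coefficients. -/

lemma finMultiIndex_apply {N : ℕ} (n : Fin N → ℕ) (j : Fin N) : finMultiIndex N n j = n j :=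
  Finsupp.embDomain_apply_self Fin.valEmbedding (Finsupp.equivFunOnFinite.symm n) j

/-- At a point of `ℂ^N` a power series is a power series in `N` variables. -/
lemma hasSum_finMultiIndex_iff {N : ℕ} {z : ℕ → ℂ} (hz : ∀ j, N ≤ j → z j = 0)
    (c : (ℕ →₀ ℕ) → ℂ) (v : ℂ) :
    HasSum (fun n : Fin N → ℕ => c (finMultiIndex N n) * ∏ j : Fin N, z j ^ n j) v ↔
      HasSum (fun α : ℕ →₀ ℕ => c α * α.prod fun j m => z j ^ m) v := by
  rw [← (finMultiIndex_injective N).hasSum_iff]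
  · simp only [Function.comp_def, finMultiIndex_prod]
  · intro α hα
    rw [mem_range_finMultiIndex] at hα
    push Not at hα
    obtain ⟨j, hj, hαj⟩ := hα
    rw [Finsupp.prod, Finset.prod_eq_zero (Finsupp.mem_support_iff.2 hαj), mul_zero]
    rw [hz j hj, zero_pow hαj]

/-- `c` are the coefficients of the power series expansion of `f` on `Omega k ∩ ℂ^N`. -/
def HasCoeffsOn {k : ℕ+} (f : Omega k → ℂ) (N : ℕ) (c : (ℕ →₀ ℕ) → ℂ) : Prop :=
  ∀ z : Omega k, (∀ j, N ≤ j → (z : ℕ → ℂ) j = 0) →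
    HasSum (fun α : ℕ →₀ ℕ => c α * α.prod fun j m => (z : ℕ → ℂ) j ^ m) (f z)

section Coefficients

variable {k : ℕ+} {f : Omega k → ℂ} {N : ℕ} {c : (ℕ →₀ ℕ) → ℂ} {r : Fin N → ℝ}

lemma HasCoeffsOn.mono {M : ℕ} (h : HasCoeffsOn f N c) (hM : M ≤ N) : HasCoeffsOn f M c :=
  fun z hz => h z fun j hj => hz j (hM.trans hj)

lemma HasCoeffsOn.hasSum_padZero (h : HasCoeffsOn f N c) {w : Fin N → ℂ}
    (hw : padZero N w ∈ Omega k) :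
    HasSum (fun n : Fin N → ℕ => c (finMultiIndex N n) * ∏ j, w j ^ n j)
      (zeroExt f (padZero N w)) := by
  have hz : ∀ j, N ≤ j → padZero N w j = 0 := fun j hj => by simp [padZero, hj]
  have := (hasSum_finMultiIndex_iff hz c _).2 (h ⟨_, hw⟩ hz)
  rw [← zeroExt_apply f] at this
  simpa [padZero] using this

lemma HasCoeffsOn.hasSum_onTorus (h : HasCoeffsOn f N c)
    (hr : ∀ j, 0 < r j ∧ r j < (weight k j)⁻¹) (t : Fin N → UnitAddCircle) :
    HasSum (fun n : Fin N → ℕ => c (finMultiIndex N n) * (∏ j, (r j : ℂ) ^ n j) *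
      UnitAddTorus.mFourier (fun j => (n j : ℤ)) t) (onTorus f N r t) := by
  have := h.hasSum_padZero (onTorus_mem hr t)
  refine this.congr_fun fun n => ?_
  have h2 := prod_torusPoint_pow r t n
  simp only [torusPoint] at h2
  rw [h2, mul_assoc]

lemma HasCoeffsOn.summable_norm (h : HasCoeffsOn f N c)
    (hr : ∀ j, 0 < r j ∧ r j < (weight k j)⁻¹) :
    Summable fun n : Fin N → ℕ => ‖c (finMultiIndex N n) * ∏ j, (r j : ℂ) ^ n j‖ := by
  -- At `t = 0` every character equals `1`.
  refine (h.hasSum_onTorus hr 0).summable.norm.congr fun n => ?_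
  rw [norm_mul]
  have : UnitAddTorus.mFourier (fun j => (n j : ℤ)) (0 : UnitAddTorus (Fin N)) = 1 := by
    change ∏ j : Fin N, fourier (n j : ℤ) (0 : UnitAddCircle) = 1
    simp
  rw [this, norm_one, mul_one]

/-- Both families are Fourier coefficients of the same function on one torus, divided by a nonzero
monomial in its radii. -/
lemma HasCoeffsOn.unique {c' : (ℕ →₀ ℕ) → ℂ} (h : HasCoeffsOn f N c) (h' : HasCoeffsOn f N c')
    {α : ℕ →₀ ℕ} (hα : α ∈ Set.range (finMultiIndex N)) : c α = c' α := by
  obtain ⟨n, rfl⟩ := hα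
  set r : Fin N → ℝ := fun j => (weight k j)⁻¹ / 2
  have hr : ∀ j : Fin N, 0 < r j ∧ r j < (weight k j)⁻¹ := fun j =>
    ⟨half_pos (inv_pos.2 (weight_pos k j)), half_lt_self (inv_pos.2 (weight_pos k j))⟩
  have h1 := mFourierCoeff_of_hasSum (natCast_comp_injective N) (h.summable_norm hr)
    (h.hasSum_onTorus hr) n
  have h2 := mFourierCoeff_of_hasSum (natCast_comp_injective N) (h'.summable_norm hr)
    (h'.hasSum_onTorus hr) n
  rw [h1] at h2
  exact mul_right_cancel₀ (Finset.prod_ne_zero_iff.2 fun j _ =>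
    pow_ne_zero _ (by exact_mod_cast (hr j).1.ne')) h2

lemma HasMonomialCoeffs.unique {c' : (ℕ →₀ ℕ) → ℂ} (h : HasMonomialCoeffs f c)
    (h' : HasMonomialCoeffs f c') : c = c' := by
  ext α
  obtain ⟨N, -, hN⟩ := exists_forall_mem_range_finMultiIndex {α}
  exact HasCoeffsOn.unique (h N) (h' N) (hN α (Finset.mem_singleton_self α))

lemma IsHolomorphic.exists_hasCoeffsOn (hf : IsHolomorphic k f) (N : ℕ) :
    ∃ c, HasCoeffsOn f N c := by
  set R : Fin N → ℝ := fun j => (weight k j)⁻¹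
  have hmem : ∀ w ∈ polydisc R, padZero N w ∈ Omega k := by
    intro w hw
    refine padZero_mem_Omega fun j => ?_
    have : ‖w j‖ < (weight k j)⁻¹ := hw j
    rw [← one_div, lt_div_iff₀ (weight_pos k j)] at this
    rwa [norm_mul, Complex.norm_real, Real.norm_of_nonneg (weight_pos k j).le]
  have hd : DifferentiableOn ℂ (fun w => zeroExt f (padZero N w)) (polydisc R) := by
    intro w hw
    have h1 := hf (padL2 k N w) (by rw [seq_padL2]; exact hmem w hw)
    have h2 : DifferentiableAt ℂ (padL2 k N) w :=
      (LinearMap.toContinuousLinearMap (padL2 k N)).differentiableAt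
    exact (h1.comp w h2).differentiableWithinAt
  obtain ⟨c, hc⟩ := exists_hasSum_polydisc (fun j => inv_pos.2 (weight_pos k j)) hd
  -- Multi-indices with further variables are truncated; their values are irrelevant because those
  -- monomials vanish at the points considered.
  refine ⟨fun α => c fun j => α j, fun z hz => ?_⟩
  rw [← hasSum_finMultiIndex_iff hz]
  have hpad : padZero N (fun j => (z : ℕ → ℂ) j) = z := by
    ext j
    by_cases hj : j < N
    · simp [padZero, hj]
    · simp [padZero, hj, hz j (not_lt.1 hj)]
  have := hc (fun j => (z : ℕ → ℂ) j) fun j => by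
    have := norm_lt_one_of_mem_Omega z.2 j
    rw [norm_mul, Complex.norm_real, Real.norm_of_nonneg (weight_pos k j).le] at this
    change ‖(z : ℕ → ℂ) j‖ < (weight k j)⁻¹
    rwa [← one_div, lt_div_iff₀ (weight_pos k j)]
  rw [hpad, zeroExt_apply] at this
  simpa only [finMultiIndex_apply] using this

/-- A holomorphic function has monomial coefficients. -/
theorem IsHolomorphic.exists_hasMonomialCoeffs (hf : IsHolomorphic k f) :
    ∃ c, HasMonomialCoeffs f c := by
  choose c hc using hf.exists_hasCoeffsOn
  have hN : ∀ α : ℕ →₀ ℕ, ∃ N, α ∈ Set.range (finMultiIndex N) := fun α => by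
    obtain ⟨N, -, hN⟩ := exists_forall_mem_range_finMultiIndex {α}
    exact ⟨N, hN α (Finset.mem_singleton_self α)⟩
  choose n hn using hN
  refine ⟨fun α => c (n α) α, fun N z hz => ?_⟩
  refine ((hasSum_finMultiIndex_iff hz (c N) _).2 (hc N z hz)).congr_fun ?_ |>
    (hasSum_finMultiIndex_iff hz _ _).1
  intro m
  have hm : finMultiIndex N m ∈ Set.range (finMultiIndex N) := ⟨m, rfl⟩
  congr 1
  -- The expansion in more variables restricts to one in fewer, where uniqueness identifies the two
  -- coefficients.
  rcases le_total N (n (finMultiIndex N m)) with h | h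
  · exact ((hc _).mono h).unique (hc N) hm
  · exact (hc _).unique ((hc N).mono h) (hn _)

/-! ### The Hardy norm as an `ℓ²`-norm of scaled coefficients. -/

/-- The monomial coefficients with respect to the variables `zⱼ 𝔭ⱼ^{1/k}`. -/
noncomputable def scaledCoeff (k : ℕ+) (c : (ℕ →₀ ℕ) → ℂ) (α : ℕ →₀ ℕ) : ℂ :=
  c α / ((α.prod fun j m => weight k j ^ m : ℝ) : ℂ)

lemma prod_weight_pos (k : ℕ+) (α : ℕ →₀ ℕ) : 0 < α.prod fun j m => weight k j ^ m :=
  Finset.prod_pos fun j _ => pow_pos (weight_pos k j) _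

lemma scaledCoeff_mul_prod (k : ℕ+) (c : (ℕ →₀ ℕ) → ℂ) (α : ℕ →₀ ℕ) (z : ℕ → ℂ) :
    (scaledCoeff k c α * α.prod fun j m => (z j * weight k j) ^ m) =
      c α * α.prod fun j m => z j ^ m := by
  have h : ((α.prod fun j m => weight k j ^ m : ℝ) : ℂ) ≠ 0 := by
    exact_mod_cast (prod_weight_pos k α).ne'
  have h2 : (α.prod fun j m => (z j * weight k j) ^ m) =
      (α.prod fun j m => z j ^ m) * ((α.prod fun j m => weight k j ^ m : ℝ) : ℂ) := by
    simp only [Finsupp.prod, mul_pow, Finset.prod_mul_distrib, Complex.ofReal_prod,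
      Complex.ofReal_pow]
  rw [h2, scaledCoeff]
  field_simp

lemma scaledCoeff_mul_prod_finMultiIndex (k : ℕ+) (c : (ℕ →₀ ℕ) → ℂ) (n : Fin N → ℕ)
    (x : Fin N → ℂ) :
    c (finMultiIndex N n) * ∏ j, x j ^ n j =
      scaledCoeff k c (finMultiIndex N n) * ∏ j, (x j * weight k j) ^ n j := by
  rw [scaledCoeff, finMultiIndex_prod]
  have h : ∏ j : Fin N, (weight k j : ℂ) ^ n j ≠ 0 :=
    Finset.prod_ne_zero_iff.2 fun j _ => pow_ne_zero _ (by exact_mod_cast (weight_pos k j).ne')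
  push_cast
  simp only [mul_pow, Finset.prod_mul_distrib]
  field_simp

lemma HasMonomialCoeffs.eLpNorm_onTorus (h : HasMonomialCoeffs f c)
    (hr : ∀ j, 0 < r j ∧ r j < (weight k j)⁻¹) :
    eLpNorm (onTorus f N r) 2 (torusMeasure N) =
      (∑' n : Fin N → ℕ, ‖scaledCoeff k c (finMultiIndex N n) *
        ∏ j, ((r j : ℂ) * weight k j) ^ n j‖ₑ ^ 2) ^ (1 / 2 : ℝ) := by
  rw [eLpNorm_of_hasSum_mFourier (natCast_comp_injective N)
    (HasCoeffsOn.summable_norm (h N) hr) (HasCoeffsOn.hasSum_onTorus (h N) hr)]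
  congr 1
  exact tsum_congr fun n => by rw [← scaledCoeff_mul_prod_finMultiIndex k c n fun j => (r j : ℂ)]

/-- The norm of the Hardy space in terms of the monomial coefficients. -/
theorem HasMonomialCoeffs.hardyENorm_eq (h : HasMonomialCoeffs f c) :
    hardyENorm k f = (∑' α, ‖scaledCoeff k c α‖ₑ ^ 2) ^ (1 / 2 : ℝ) := by
  apply le_antisymm
  -- By Parseval each torus norm is a sum over fewer multi-indices with extra factors `(r j * weight
  -- k j) ^ n j` of modulus at most `1`.
  · refine iSup₂_le fun N _ => iSup₂_le fun r hr => ?_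
    refine (h.eLpNorm_onTorus hr).trans_le (ENNReal.rpow_le_rpow ?_ (by norm_num))
    refine le_trans (ENNReal.tsum_le_tsum fun n => ?_)
      (ENNReal.tsum_comp_le_tsum_of_injective (finMultiIndex_injective N) _)
    rw [enorm_mul]
    refine pow_le_pow_left' (mul_le_of_le_one_right' ?_) 2
    rw [← ofReal_norm, ENNReal.ofReal_le_one, norm_prod]
    refine Finset.prod_le_one (fun j _ => norm_nonneg _) fun j _ => ?_
    have h1 := (hr j).2
    rw [← one_div, lt_div_iff₀ (weight_pos k j)] at h1
    rw [norm_pow, norm_mul, Complex.norm_real, Complex.norm_real,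
      Real.norm_of_nonneg (hr j).1.le, Real.norm_of_nonneg (weight_pos k j).le]
    exact pow_le_one₀ (mul_nonneg (hr j).1.le (weight_pos k j).le) h1.le
  · have hsq : ∑' α, ‖scaledCoeff k c α‖ₑ ^ 2 ≤ hardyENorm k f ^ 2 := by
      rw [ENNReal.tsum_eq_iSup_sum]
      refine iSup_le fun S => ?_
      obtain ⟨N, hN1, T, hT⟩ := exists_eq_map_finMultiIndex S
      -- For a finite set `S`, tori with `r j * weight k j = ρ` for all `j` recover the full sum as
      -- `ρ` increases to `1`.
      have hlim : Tendsto (fun ρ : ℝ => ∑ α ∈ S,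
          ‖scaledCoeff k c α * α.prod fun _ m => (ρ : ℂ) ^ m‖ₑ ^ 2) (𝓝[<] 1)
          (𝓝 (∑ α ∈ S, ‖scaledCoeff k c α‖ₑ ^ 2)) := by
        have hc : Continuous fun ρ : ℝ => ∑ α ∈ S,
            ‖scaledCoeff k c α * α.prod fun _ m => (ρ : ℂ) ^ m‖ₑ ^ 2 := by
          refine continuous_finsetSum _ fun α _ => (ENNReal.continuous_pow 2).comp
            (continuous_enorm.comp (continuous_const.mul ?_))
          exact continuous_finsetProd _ fun j _ => by fun_prop
        have := (hc.tendsto 1).mono_left (nhdsWithin_le_nhds (s := Set.Iio 1))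
        simpa [Finsupp.prod] using this
      refine le_of_tendsto hlim ?_
      filter_upwards [Ioo_mem_nhdsLT (show (0 : ℝ) < 1 by norm_num)] with ρ hρ
      set r : Fin N → ℝ := fun j => ρ * (weight k j)⁻¹ with hrdef
      have hr : ∀ j : Fin N, 0 < r j ∧ r j < (weight k j)⁻¹ := fun j =>
        ⟨mul_pos hρ.1 (inv_pos.2 (weight_pos k j)),
          mul_lt_of_lt_one_left (inv_pos.2 (weight_pos k j)) hρ.2⟩
      have hle : eLpNorm (onTorus f N r) 2 (torusMeasure N) ≤ hardyENorm k f :=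
        le_iSup₂_of_le N hN1 (le_iSup₂_of_le r hr le_rfl)
      have hrw : ∀ j : Fin N, (r j : ℂ) * weight k j = ρ := fun j => by
        have : (weight k j : ℂ) ≠ 0 := by exact_mod_cast (weight_pos k j).ne'
        simp only [hrdef]
        push_cast
        field_simp
      refine le_trans ?_ (pow_le_pow_left' hle 2)
      rw [h.eLpNorm_onTorus hr, ← ENNReal.rpow_natCast, ← ENNReal.rpow_mul]
      norm_num
      simp only [hrw]
      rw [hT, Finset.sum_map]
      refine le_trans (le_of_eq ?_) (ENNReal.sum_le_tsum T)
      refine Finset.sum_congr rfl fun n _ => ?_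
      rw [Function.Embedding.coeFn_mk, finMultiIndex_prod N n (fun _ => (ρ : ℂ))]
    refine (ENNReal.rpow_le_rpow hsq (by norm_num)).trans ?_
    rw [← ENNReal.rpow_natCast, ← ENNReal.rpow_mul]
    norm_num

end Coefficients

/-! ### Power series with square summable scaled coefficients. -/

/-- The sum of the power series with coefficients `c` at the point `z`. -/
noncomputable def monomialSum (c : (ℕ →₀ ℕ) → ℂ) (z : ℕ → ℂ) : ℂ :=
  ∑' α : ℕ →₀ ℕ, c α * α.prod fun j m => z j ^ m

section Series

variable {k : ℕ+} {c : (ℕ →₀ ℕ) → ℂ}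

lemma WeightedL2.norm_apply_le (y : WeightedL2 k) (j : ℕ) :
    ‖WeightedL2.seq k y j * weight k j‖ ≤ ‖y‖ :=
  lp.norm_apply_le_norm (by simp) (WeightedL2.toLp k y) j

lemma WeightedL2.hasSum_sq (y : WeightedL2 k) :
    HasSum (fun j => ‖WeightedL2.seq k y j * weight k j‖ ^ 2) (‖y‖ ^ 2) := by
  have := lp.hasSum_norm (p := 2) (by simp) (WeightedL2.toLp k y)
  simp only [ENNReal.toReal_ofNat, Real.rpow_ofNat] at this
  exact this

/-- The coordinate functionals of `ℓ₂(𝔭^{1/k})`. -/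
noncomputable def WeightedL2.coordCLM (k : ℕ+) (j : ℕ) : WeightedL2 k →L[ℂ] ℂ :=
  ((LinearMap.proj j).comp (WeightedL2.seq k)).mkContinuous (weight k j)⁻¹ fun y => by
    have h := WeightedL2.norm_apply_le y j
    rw [norm_mul, Complex.norm_real, Real.norm_of_nonneg (weight_pos k j).le] at h
    rw [inv_mul_eq_div, le_div_iff₀ (weight_pos k j)]
    exact h

lemma WeightedL2.differentiable_seq (j : ℕ) :
    Differentiable ℂ fun y : WeightedL2 k => WeightedL2.seq k y j :=
  (WeightedL2.coordCLM k j).differentiable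

lemma WeightedL2.differentiable_prod (α : ℕ →₀ ℕ) :
    Differentiable ℂ fun y : WeightedL2 k => α.prod fun j m => WeightedL2.seq k y j ^ m := by
  classical
  exact fun y => (HasFDerivAt.finsetProd fun j _ =>
    ((WeightedL2.differentiable_seq j y).fun_pow (α j)).hasFDerivAt).differentiableAt

/-- The squares of the monomials are monomials in `|yⱼ 𝔭ⱼ^{1/k}|²`, a summable sequence bounded by
`ρ² < 1`. The bound depends only on `‖y‖` and `ρ`, hence is locally uniform on `Omega k`. -/
lemma WeightedL2.sum_prod_sq_le {y : WeightedL2 k} {ρ : ℝ} (hρ0 : 0 ≤ ρ) (hρ : ρ < 1)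
    (hy : ∀ j, ‖WeightedL2.seq k y j * weight k j‖ ≤ ρ) (S : Finset (ℕ →₀ ℕ)) :
    ∑ α ∈ S, ‖α.prod fun j m => (WeightedL2.seq k y j * weight k j) ^ m‖ ^ 2 ≤
      Real.exp (‖y‖ ^ 2 / (1 - ρ ^ 2)) := by
  have h := sum_monomial_le_exp (x := fun j => ‖WeightedL2.seq k y j * weight k j‖ ^ 2)
    (ρ := ρ ^ 2) (fun j => by positivity) (fun j => pow_le_pow_left₀ (norm_nonneg _) (hy j) 2)
    (by nlinarith) y.hasSum_sq.summable S
  rw [y.hasSum_sq.tsum_eq] at h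
  refine le_trans (le_of_eq (Finset.sum_congr rfl fun α _ => ?_)) h
  rw [Finsupp.prod, Finsupp.prod, norm_prod, ← Finset.prod_pow]
  exact Finset.prod_congr rfl fun j _ => by rw [norm_pow, pow_right_comm]

/-- The Cauchy-Schwarz inequality for finite partial sums of a power series. -/
lemma norm_sum_le_sqrt {y : WeightedL2 k} {ρ : ℝ} (hρ0 : 0 ≤ ρ) (hρ : ρ < 1)
    (hy : ∀ j, ‖WeightedL2.seq k y j * weight k j‖ ≤ ρ) (S : Finset (ℕ →₀ ℕ)) :
    ∑ α ∈ S, ‖c α * α.prod fun j m => WeightedL2.seq k y j ^ m‖ ≤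
      √(∑ α ∈ S, ‖scaledCoeff k c α‖ ^ 2) * √(Real.exp (‖y‖ ^ 2 / (1 - ρ ^ 2))) := by
  have h : ∀ α : ℕ →₀ ℕ, ‖c α * α.prod fun j m => WeightedL2.seq k y j ^ m‖ =
      ‖scaledCoeff k c α‖ *
        ‖α.prod fun j m => (WeightedL2.seq k y j * weight k j) ^ m‖ := fun α => by
    rw [← scaledCoeff_mul_prod k, norm_mul]
  simp only [h]
  refine (Real.sum_mul_le_sqrt_mul_sqrt S _ _).trans ?_
  exact mul_le_mul_of_nonneg_left (Real.sqrt_le_sqrt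
    (WeightedL2.sum_prod_sq_le hρ0 hρ hy S)) (Real.sqrt_nonneg _)

lemma WeightedL2.mem_Omega_of_le {y : WeightedL2 k} {ρ : ℝ} (hρ : ρ < 1)
    (hy : ∀ j, ‖WeightedL2.seq k y j * weight k j‖ ≤ ρ) : WeightedL2.seq k y ∈ Omega k :=
  ⟨y.2, ⟨ρ, Set.forall_mem_range.2 hy⟩, (ciSup_le hy).trans_lt hρ⟩

lemma WeightedL2.exists_le_of_mem_Omega {y : WeightedL2 k} (hy : WeightedL2.seq k y ∈ Omega k) :
    ∃ ρ : ℝ, 0 ≤ ρ ∧ ρ < 1 ∧ ∀ j, ‖WeightedL2.seq k y j * weight k j‖ ≤ ρ :=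
  ⟨_, (norm_nonneg _).trans (le_ciSup hy.2.1 0), hy.2.2, le_ciSup hy.2.1⟩

/-- Power series with square summable coefficients converge absolutely on `Omega k`. -/
lemma hasSum_monomialSum (hc : Summable fun α => ‖scaledCoeff k c α‖ ^ 2) {z : ℕ → ℂ}
    (hz : z ∈ Omega k) :
    HasSum (fun α : ℕ →₀ ℕ => c α * α.prod fun j m => z j ^ m) (monomialSum c z) := by
  set y : WeightedL2 k := ⟨z, hz.1⟩
  obtain ⟨ρ, hρ0, hρ, hy⟩ := WeightedL2.exists_le_of_mem_Omega (y := y) hz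
  refine Summable.hasSum (Summable.of_norm (summable_of_sum_le
    (c := √(∑' α, ‖scaledCoeff k c α‖ ^ 2) * √(Real.exp (‖y‖ ^ 2 / (1 - ρ ^ 2))))
    (fun α => norm_nonneg _) fun S => ?_))
  refine (norm_sum_le_sqrt hρ0 hρ hy S).trans ?_
  gcongr
  exact hc.sum_le_tsum S fun α _ => by positivity

/-- The sum of a power series with square summable coefficients is holomorphic. -/
theorem isHolomorphic_monomialSum (hc : Summable fun α => ‖scaledCoeff k c α‖ ^ 2) :
    IsHolomorphic k fun z => monomialSum c z := by
  intro z hz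
  obtain ⟨ρ, hρ0, hρ, hy⟩ := WeightedL2.exists_le_of_mem_Omega hz
  -- Half of the gap to `1`: the norm dominates each weighted coordinate, so on the ball of radius
  -- `δ` these stay below `ρ + δ < 1`.
  set δ := (1 - ρ) / 2 with hδ
  have hδ0 : 0 < δ := by linarith
  have hρδ : ρ + δ < 1 := by linarith
  have hball : ∀ w ∈ Metric.ball z δ, ∀ j, ‖WeightedL2.seq k w j * weight k j‖ ≤ ρ + δ := by
    intro w hw j
    have h1 := WeightedL2.norm_apply_le (w - z) j
    rw [mem_ball_iff_norm] at hw
    have h2 : WeightedL2.seq k w j * weight k j = WeightedL2.seq k z j * weight k j +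
        WeightedL2.seq k (w - z) j * weight k j := by
      rw [map_sub, Pi.sub_apply]; ring
    rw [h2]
    exact (norm_add_le _ _).trans (add_le_add (hy j) (h1.trans hw.le))
  have hmem : ∀ w ∈ Metric.ball z δ, WeightedL2.seq k w ∈ Omega k := fun w hw =>
    WeightedL2.mem_Omega_of_le hρδ (hball w hw)
  -- The Cauchy-Schwarz factor at the largest norm and weighted coordinates possible in the ball.
  set K := √(Real.exp ((‖z‖ + δ) ^ 2 / (1 - (ρ + δ) ^ 2))) with hK
  have hK0 : 0 < K := Real.sqrt_pos.2 (Real.exp_pos _)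
  have hbound : ∀ w ∈ Metric.ball z δ, ∀ S : Finset (ℕ →₀ ℕ),
      ‖∑ α ∈ S, c α * α.prod fun j m => WeightedL2.seq k w j ^ m‖ ≤
        √(∑ α ∈ S, ‖scaledCoeff k c α‖ ^ 2) * K := by
    intro w hw S
    refine (norm_sum_le _ _).trans ((norm_sum_le_sqrt (by linarith) hρδ (hball w hw) S).trans ?_)
    have h1 : ‖w‖ ≤ ‖z‖ + δ := by
      rw [mem_ball_iff_norm] at hw
      have := norm_add_le z (w - z)
      rw [add_sub_cancel] at this
      linarith
    have h2 : 0 < 1 - (ρ + δ) ^ 2 := by nlinarith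
    refine mul_le_mul_of_nonneg_left (Real.sqrt_le_sqrt (Real.exp_le_exp.2 ?_)) (Real.sqrt_nonneg _)
    gcongr
  have hunif : TendstoUniformlyOn (fun (S : Finset (ℕ →₀ ℕ)) (w : WeightedL2 k) =>
      ∑ α ∈ S, c α * α.prod fun j m => WeightedL2.seq k w j ^ m)
      (fun w => monomialSum c (WeightedL2.seq k w)) atTop (Metric.ball z δ) := by
    rw [Metric.tendstoUniformlyOn_iff]
    intro ε hε
    -- Coefficient sums off `S₀` are below `(ε / 2 / K) ^ 2`, so the partial sums over `S` and any
    -- larger `T` differ by at most `ε / 2` throughout the ball; then let `T` grow.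
    obtain ⟨S₀, hS₀⟩ := summable_iff_vanishing_norm.1 hc ((ε / 2 / K) ^ 2) (by positivity)
    filter_upwards [eventually_ge_atTop S₀] with S hS w hw
    have hle : dist (monomialSum c (WeightedL2.seq k w))
        (∑ α ∈ S, c α * α.prod fun j m => WeightedL2.seq k w j ^ m) ≤ ε / 2 := by
      have hlim := (hasSum_monomialSum hc (hmem w hw)).dist
        (tendsto_const_nhds (x := ∑ α ∈ S, c α * α.prod fun j m => WeightedL2.seq k w j ^ m))
      refine le_of_tendsto hlim ?_
      filter_upwards [eventually_ge_atTop S] with T hT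
      classical
      rw [dist_eq_norm, ← Finset.sum_sdiff hT, add_sub_cancel_right]
      refine (hbound w hw (T \ S)).trans ?_
      have h1 := hS₀ (T \ S) (Finset.disjoint_of_subset_right hS Finset.sdiff_disjoint)
      rw [Real.norm_of_nonneg (Finset.sum_nonneg fun α _ => by positivity)] at h1
      have h2 : √(∑ α ∈ T \ S, ‖scaledCoeff k c α‖ ^ 2) ≤ ε / 2 / K :=
        Real.sqrt_le_iff.2 ⟨by positivity, h1.le⟩
      exact (le_div_iff₀ hK0).1 h2
    linarith
  have hd := differentiableAt_of_tendstoUniformlyOn_ball hδ0 (fun S =>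
    (Differentiable.fun_sum fun α _ => (WeightedL2.differentiable_prod α).const_mul
      (c α)).differentiableOn) hunif
  refine hd.congr_of_eventuallyEq ?_
  filter_upwards [Metric.ball_mem_nhds z hδ0] with w hw
  exact zeroExt_apply (fun z : Omega k => monomialSum c z) ⟨_, hmem w hw⟩

lemma hasMonomialCoeffs_monomialSum (hc : Summable fun α => ‖scaledCoeff k c α‖ ^ 2) :
    HasMonomialCoeffs (fun z : Omega k => monomialSum c z) c :=
  fun _ z _ => hasSum_monomialSum hc z.2

lemma tsum_enorm_sq_eq {ι : Type*} {b : ι → ℂ} (hb : Summable fun i => ‖b i‖ ^ 2) :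
    ∑' i, ‖b i‖ₑ ^ 2 = ENNReal.ofReal (∑' i, ‖b i‖ ^ 2) := by
  rw [ENNReal.ofReal_tsum_of_nonneg (fun i => by positivity) hb]
  exact tsum_congr fun i => by rw [ENNReal.ofReal_pow (norm_nonneg _), ofReal_norm]

lemma tsum_enorm_sq_lt_top_iff {ι : Type*} {b : ι → ℂ} :
    ∑' i, ‖b i‖ₑ ^ 2 < ∞ ↔ Summable fun i => ‖b i‖ ^ 2 := by
  constructor
  · intro h
    have := ENNReal.summable_toReal h.ne
    simpa using this
  · intro h
    rw [tsum_enorm_sq_eq h]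
    exact ENNReal.ofReal_lt_top

lemma HasMonomialCoeffs.hardyENorm_lt_top_iff {f : Omega k → ℂ} (h : HasMonomialCoeffs f c) :
    hardyENorm k f < ∞ ↔ Summable fun α => ‖scaledCoeff k c α‖ ^ 2 := by
  rw [h.hardyENorm_eq, ← tsum_enorm_sq_lt_top_iff, ENNReal.rpow_lt_top_iff_of_pos (by norm_num)]

lemma HasMonomialCoeffs.toReal_hardyENorm {f : Omega k → ℂ} (h : HasMonomialCoeffs f c)
    (hc : Summable fun α => ‖scaledCoeff k c α‖ ^ 2) :
    (hardyENorm k f).toReal = (∑' α, ‖scaledCoeff k c α‖ ^ 2) ^ (1 / 2 : ℝ) := by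
  rw [h.hardyENorm_eq, tsum_enorm_sq_eq hc, ← ENNReal.toReal_rpow, ENNReal.toReal_ofReal]
  exact tsum_nonneg fun α => by positivity

lemma monomialSum_mem_hardyFunctions (hc : Summable fun α => ‖scaledCoeff k c α‖ ^ 2) :
    (fun z : Omega k => monomialSum c z) ∈ hardyFunctions k :=
  ⟨isHolomorphic_monomialSum hc,
    (hasMonomialCoeffs_monomialSum hc).hardyENorm_lt_top_iff.2 hc⟩

/-- The functions in the Hardy space are the sums of the power series with square summable
coefficients. -/
theorem exists_eq_monomialSum {f : Omega k → ℂ} (hf : f ∈ hardyFunctions k) :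
    ∃ c, HasMonomialCoeffs f c ∧ Summable (fun α => ‖scaledCoeff k c α‖ ^ 2) ∧
      f = fun z : Omega k => monomialSum c z := by
  obtain ⟨c, hc⟩ := IsHolomorphic.exists_hasMonomialCoeffs hf.1
  have hs := hc.hardyENorm_lt_top_iff.1 hf.2
  refine ⟨c, hc, hs, ?_⟩
  -- The function minus the sum of its series has zero coefficients, hence norm zero, hence
  -- vanishes.
  have hsub := sub_mem hf (monomialSum_mem_hardyFunctions hs)
  have h0 : HasMonomialCoeffs (f - fun z : Omega k => monomialSum c z) 0 := by
    intro N z hz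
    have := (hc N z hz).sub (hasMonomialCoeffs_monomialSum hs N z hz)
    simpa using this
  rw [← sub_eq_zero]
  refine eq_zero_of_hardyENorm_eq_zero hsub.1 ?_
  rw [h0.hardyENorm_eq]
  simp [scaledCoeff]

end Series

/-! ### The isometry between `𝓗²ₖ` and the Hardy space. -/

section Correspondence

variable {k : ℕ+}

/-- The multi-indices enumerate the positive integers. -/
noncomputable def primePowEquiv : (ℕ →₀ ℕ) ≃ ℕ+ := Equiv.ofBijective primePow primePow_bijective

/-- Scaling the variables on the function side is the translation by `1/k` on the Dirichlet side;
all norm comparisons rest on this. -/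
lemma scaledCoeff_comp_primePow (k : ℕ+) (a : ℕ+ → ℂ) (α : ℕ →₀ ℕ) :
    scaledCoeff k (fun α => a (primePow α)) α = shiftSeries (1 / (k : ℝ)) a (primePow α) := by
  rw [scaledCoeff, ← primePow_rpow]
  rfl

lemma mem_h2kSeries_iff {a : ℕ+ → ℂ} :
    a ∈ h2kSeries k ↔ Summable fun α => ‖scaledCoeff k (fun α => a (primePow α)) α‖ ^ 2 := by
  change shiftSeries (1 / (k : ℝ)) a ∈ h2Series ↔ _
  rw [mem_h2Series_iff, memℓp_gen_iff (by simp)]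
  simp only [ENNReal.toReal_ofNat, Real.rpow_ofNat, scaledCoeff_comp_primePow]
  exact (primePowEquiv.summable_iff
    (f := fun n => ‖shiftSeries (1 / (k : ℝ)) a n‖ ^ 2)).symm

lemma DirichletH2k.coeffs_toH2 (D : DirichletH2k k) :
    DirichletH2.coeffs (DirichletH2k.toH2 k D) =
      shiftSeries (1 / (k : ℝ)) (DirichletH2k.coeffs k D) :=
  congrArg Subtype.val (LinearEquiv.apply_symm_apply
    (LinearEquiv.ofInjective DirichletH2.coeffs DirichletH2.coeffs_injective) _)

lemma DirichletH2k.norm_eq (D : DirichletH2k k) :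
    ‖D‖ = (∑' α, ‖scaledCoeff k (fun α => DirichletH2k.coeffs k D (primePow α)) α‖ ^ 2) ^
      (1 / 2 : ℝ) := by
  change ‖DirichletH2k.toH2 k D‖ = _
  rw [← DirichletH2.norm_toLpCLM, lp.norm_eq_tsum_rpow (by simp)]
  simp only [ENNReal.toReal_ofNat, Real.rpow_ofNat, scaledCoeff_comp_primePow]
  congr 1
  rw [← primePowEquiv.tsum_eq]
  refine tsum_congr fun α => ?_
  rw [DirichletH2.toLpCLM_apply, DirichletH2k.coeffs_toH2]
  rfl

/-- Multiplying the coefficients by `n^{1/k}` undoes the translation. Hence `𝓗²ₖ` is isometric to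
`𝓗²` and inherits its completeness. -/
lemma DirichletH2k.toH2_surjective (k : ℕ+) : Function.Surjective (DirichletH2k.toH2 k) := by
  intro x
  set a : ℕ+ → ℂ := fun n => DirichletH2.coeffs x n * (((n : ℝ) ^ (1 / (k : ℝ)) : ℝ) : ℂ)
  have hshift : shiftSeries (1 / (k : ℝ)) a = DirichletH2.coeffs x := by
    ext n
    have hn : (((n : ℝ) ^ (1 / (k : ℝ)) : ℝ) : ℂ) ≠ 0 := by
      exact_mod_cast (Real.rpow_pos_of_pos (Nat.cast_pos.2 n.pos) _).ne'
    exact mul_div_cancel_right₀ _ hn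
  have hmem : a ∈ h2kSeries k := by
    change shiftSeries (1 / (k : ℝ)) a ∈ h2Series
    rw [hshift]
    exact ⟨x, rfl⟩
  exact ⟨⟨a, hmem⟩, DirichletH2.coeffs_injective ((DirichletH2k.coeffs_toH2 _).trans hshift)⟩

lemma DirichletH2k.completeSpace (k : ℕ+) : CompleteSpace (DirichletH2k k) := by
  have hiso : Isometry (DirichletH2k.toH2 k) :=
    AddMonoidHomClass.isometry_of_norm _ fun _ => rfl
  exact (hiso.isUniformInducing.completeSpace_congr (DirichletH2k.toH2_surjective k)).2
    inferInstance

lemma DirichletH2k.summable (D : DirichletH2k k) :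
    Summable fun α =>
      ‖scaledCoeff k (fun α => DirichletH2k.coeffs k D (primePow α)) α‖ ^ 2 :=
  mem_h2kSeries_iff.1 D.2

lemma monomialSum_add {c d : (ℕ →₀ ℕ) → ℂ} {z : ℕ → ℂ} (hz : z ∈ Omega k)
    (hc : Summable fun α => ‖scaledCoeff k c α‖ ^ 2)
    (hd : Summable fun α => ‖scaledCoeff k d α‖ ^ 2) :
    monomialSum (fun α => c α + d α) z = monomialSum c z + monomialSum d z := by
  rw [← ((hasSum_monomialSum hc hz).add (hasSum_monomialSum hd hz)).tsum_eq]
  exact tsum_congr fun α => add_mul _ _ _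

lemma monomialSum_smul (r : ℂ) (c : (ℕ →₀ ℕ) → ℂ) (z : ℕ → ℂ) :
    monomialSum (fun α => r * c α) z = r * monomialSum c z := by
  simp only [monomialSum, mul_assoc, tsum_mul_left]

/-- The isometry of `𝓗²ₖ` into the Hardy space that preserves the coefficients. -/
noncomputable def DirichletH2k.toHardy (k : ℕ+) : DirichletH2k k →ₗᵢ[ℂ] HardyH2 k where
  toFun D := ⟨fun z => monomialSum (fun α => DirichletH2k.coeffs k D (primePow α)) z,
    monomialSum_mem_hardyFunctions D.summable⟩
  map_add' D E := Subtype.ext (funext fun z => monomialSum_add z.2 D.summable E.summable)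
  map_smul' r _ := Subtype.ext (funext fun z => monomialSum_smul r _ z)
  norm_map' D := ((hasMonomialCoeffs_monomialSum D.summable).toReal_hardyENorm D.summable).trans
    D.norm_eq.symm

lemma DirichletH2k.hasMonomialCoeffs_toHardy (D : DirichletH2k k) :
    HasMonomialCoeffs (HardyH2.toFun k (DirichletH2k.toHardy k D))
      (fun α => DirichletH2k.coeffs k D (primePow α)) :=
  hasMonomialCoeffs_monomialSum D.summable

lemma comp_primePowEquiv_symm (c : (ℕ →₀ ℕ) → ℂ) :
    (fun α => (c ∘ primePowEquiv.symm) (primePow α)) = c :=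
  funext fun α => congrArg c (primePowEquiv.symm_apply_apply α)

lemma comp_primePowEquiv_symm_mem {c : (ℕ →₀ ℕ) → ℂ}
    (hc : Summable fun α => ‖scaledCoeff k c α‖ ^ 2) : c ∘ primePowEquiv.symm ∈ h2kSeries k := by
  rw [mem_h2kSeries_iff, comp_primePowEquiv_symm]
  exact hc

lemma DirichletH2k.toHardy_surjective (k : ℕ+) :
    Function.Surjective (DirichletH2k.toHardy k) := by
  intro f
  obtain ⟨c, -, hs, hf⟩ := exists_eq_monomialSum f.2
  refine ⟨⟨_, comp_primePowEquiv_symm_mem hs⟩, Subtype.ext (Eq.trans ?_ hf.symm)⟩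
  ext z
  exact congrArg (fun c => monomialSum c z) (comp_primePowEquiv_symm c)

/-- The isometric isomorphism of `𝓗²ₖ` and the Hardy space. -/
noncomputable def DirichletH2k.equivHardy (k : ℕ+) : DirichletH2k k ≃ₗᵢ[ℂ] HardyH2 k :=
  LinearIsometryEquiv.ofSurjective (DirichletH2k.toHardy k) (DirichletH2k.toHardy_surjective k)

/-- Completeness is carried over from `𝓗²ₖ` by the surjective isometry. -/
lemma HardyH2.completeSpace (k : ℕ+) : CompleteSpace (HardyH2 k) :=
  ((DirichletH2k.toHardy k).isometry.isUniformInducing.completeSpace_congr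
    (DirichletH2k.toHardy_surjective k)).1 (DirichletH2k.completeSpace k)

/-! ### The intersection of the Hardy spaces and `𝓗₊`. -/

lemma weight_anti {k l : ℕ+} (h : k ≤ l) (j : ℕ) : weight l j ≤ weight k j := by
  have h1 : (1 : ℝ) ≤ primeSeq j := by exact_mod_cast primeSeq_pos j
  have h2 : (0 : ℝ) < k := Nat.cast_pos.2 k.pos
  have h3 : (k : ℝ) ≤ l := by exact_mod_cast h
  exact Real.rpow_le_rpow_of_exponent_le h1 (one_div_le_one_div_of_le h2 h3)

lemma Omega_mono {k l : ℕ+} (h : k ≤ l) : Omega k ⊆ Omega l := by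
  intro z hz
  have hle : ∀ j, ‖z j * weight l j‖ ≤ ‖z j * weight k j‖ := fun j => by
    rw [norm_mul, norm_mul, Complex.norm_real, Complex.norm_real,
      Real.norm_of_nonneg (weight_pos l j).le, Real.norm_of_nonneg (weight_pos k j).le]
    exact mul_le_mul_of_nonneg_left (weight_anti h j) (norm_nonneg _)
  have hle' : ∀ j, ‖z j * weight l j‖ ≤ ⨆ j, ‖z j * weight k j‖ := fun j =>
    (hle j).trans (le_ciSup hz.2.1 j)
  exact ⟨Memℓp.mono' (show Memℓp (weightMul k z) 2 from hz.1) hle,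
    ⟨_, Set.forall_mem_range.2 hle'⟩, (ciSup_le hle').trans_lt hz.2.2⟩

lemma HPlus.summable (D : HPlus) (k : ℕ+) :
    Summable fun α => ‖scaledCoeff k (fun α => HPlus.coeffs D (primePow α)) α‖ ^ 2 :=
  (HPlus.incl k D).summable

/-- The map of `𝓗₊` into the intersection of the Hardy spaces that preserves the coefficients. -/
noncomputable def HPlus.toHardyInter : HPlus →ₗ[ℂ] HardyInter where
  toFun D := ⟨fun z => monomialSum (fun α => HPlus.coeffs D (primePow α)) z,
    (Submodule.mem_iInf _).2 fun k => monomialSum_mem_hardyFunctions (D.summable k)⟩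
  map_add' D E := Subtype.ext (funext fun z => by
    obtain ⟨k, hk⟩ := Set.mem_iUnion.1 z.2
    exact monomialSum_add hk (D.summable k) (E.summable k))
  map_smul' r D := Subtype.ext (funext fun z => monomialSum_smul r _ z)

/-- The commuting square that reduces statements about the intersection to the isometries at each
level `k`. -/
lemma HPlus.toHardy_toHardyInter (D : HPlus) (k : ℕ+) :
    HardyInter.toHardy k (HPlus.toHardyInter D) = DirichletH2k.toHardy k (HPlus.incl k D) :=
  rfl

lemma HPlus.toHardyInter_bijective : Function.Bijective HPlus.toHardyInter := by
  constructor
  · intro D E h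
    have h1 : DirichletH2k.toHardy 1 (HPlus.incl 1 D) =
        DirichletH2k.toHardy 1 (HPlus.incl 1 E) := by
      rw [← HPlus.toHardy_toHardyInter, h, HPlus.toHardy_toHardyInter]
    exact Submodule.inclusion_injective (hplusSeries_le 1) ((DirichletH2k.toHardy 1).injective h1)
  · intro f
    choose c hc hs hf using fun k : ℕ+ => exists_eq_monomialSum ((Submodule.mem_iInf _).1 f.2 k)
    -- Each expansion is valid on the smallest domain `Omega 1`, where the coefficients are unique.
    have hcc : ∀ k, c k = c 1 := by
      intro k
      have h1 : HasMonomialCoeffs (restrictOmega 1 f.1) (c k) := fun N z hz =>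
        hc k N ⟨z, Omega_mono (one_le (a := k)) z.2⟩ hz
      exact h1.unique (hc 1)
    have hmem : c 1 ∘ primePowEquiv.symm ∈ hplusSeries :=
      (hplus_iff _).2 ((Submodule.mem_iInf _).2 fun k =>
        comp_primePowEquiv_symm_mem (hcc k ▸ hs k))
    refine ⟨⟨_, hmem⟩, Subtype.ext (funext fun z => ?_)⟩
    obtain ⟨k, hk⟩ := Set.mem_iUnion.1 z.2
    refine (congrArg (fun c => monomialSum c z) (comp_primePowEquiv_symm (c 1))).trans ?_
    rw [← hcc k]
    exact (congrFun (hf k) ⟨z, hk⟩).symm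

/-- A family of seminorms generates the infimum of their individual topologies, and for the `k`-th
seminorm `HPlus.incl k` is an isometry. -/
lemma HPlus.topology_eq : (inferInstance : TopologicalSpace HPlus) =
    ⨅ k : ℕ+, TopologicalSpace.induced (HPlus.incl k) inferInstance := by
  have hp : WithSeminorms HPlus.seminorms := ⟨rfl⟩
  have := hp.topologicalAddGroup
  refine (HPlus.seminorms.withSeminorms_iff_topologicalSpace_eq_iInf.1 hp).trans
    (iInf_congr fun k => ?_)
  let _ := (HPlus.seminorms k).toSeminormedAddCommGroup
  have h : Isometry (HPlus.incl k) := AddMonoidHomClass.isometry_of_norm _ fun _ => rfl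
  exact @IsInducing.eq_induced _ _ (_) (_) _
    (@IsUniformInducing.isInducing _ _ (_) (_) _ h.isUniformInducing)

/-- Both topologies are infima of pulled back norm topologies, and they match for each `k` because
`DirichletH2k.toHardy k` is an isometry. -/
lemma HPlus.isInducing_toHardyInter : IsInducing HPlus.toHardyInter := by
  refine ⟨HPlus.topology_eq.trans ?_⟩
  change _ = TopologicalSpace.induced _ (⨅ k : ℕ+, _)
  rw [induced_iInf]
  refine iInf_congr fun k => ?_
  rw [induced_compose]
  change _ = TopologicalSpace.induced (DirichletH2k.toHardy k ∘ HPlus.incl k) _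
  rw [← induced_compose,
    ← (DirichletH2k.toHardy k).isometry.isUniformInducing.isInducing.eq_induced]

/-- The isomorphism of `𝓗₊` and the intersection of the Hardy spaces. -/
noncomputable def HPlus.equivHardyInter : HPlus ≃L[ℂ] HardyInter where
  toLinearEquiv := LinearEquiv.ofBijective HPlus.toHardyInter HPlus.toHardyInter_bijective
  continuous_toFun := HPlus.isInducing_toHardyInter.continuous
  continuous_invFun := by
    refine HPlus.isInducing_toHardyInter.continuous_iff.2 ?_
    refine continuous_id.congr fun f => ?_
    exact (LinearEquiv.apply_symm_apply
      (LinearEquiv.ofBijective HPlus.toHardyInter HPlus.toHardyInter_bijective) f).symm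

end Correspondence

theorem corollary3p6 :
    (∀ k : ℕ+, CompleteSpace (DirichletH2k k) ∧ CompleteSpace (HardyH2 k) ∧
      ∃ Φ : DirichletH2k k ≃ₗᵢ[ℂ] HardyH2 k, ∀ D : DirichletH2k k,
        HasMonomialCoeffs (HardyH2.toFun k (Φ D))
          (fun α => DirichletH2k.coeffs k D (primePow α))) ∧
    ∃ Ψ : HPlus ≃L[ℂ] HardyInter, ∀ (D : HPlus) (k : ℕ+),
      HasMonomialCoeffs (HardyH2.toFun k (HardyInter.toHardy k (Ψ D)))
        (fun α => HPlus.coeffs D (primePow α)) ∧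
      ‖HardyInter.toHardy k (Ψ D)‖ = HPlus.seminorms k D :=
  ⟨fun k => ⟨DirichletH2k.completeSpace k, HardyH2.completeSpace k, DirichletH2k.equivHardy k,
    fun D => D.hasMonomialCoeffs_toHardy⟩,
  HPlus.equivHardyInter, fun D k => ⟨(HPlus.incl k D).hasMonomialCoeffs_toHardy,
    (DirichletH2k.toHardy k).norm_map (HPlus.incl k D)⟩⟩
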